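/- Let $\mathbb{H}\subset\mathbb{C}$ be the open upper half-plane. Let $C_{\{x,y,z\},\{0,1\}}$ be the moduli space of disks with interior marked points $x,y,z$ and boundary marked points $0<1,\infty$. That is, it is the quotient of $$\{(x,y,z)\in\mathbb{H}^3 \text{ pairwise distinct}\}\times\{(q_0,q_1)\in\mathbb{R}^2: q_0<q_1\}$$ by the group of maps $w\mapsto aw+b$ ($a>0$, $b\in\mathbb{R}$) acting diagonally. Normalizing $q_0=0$, $q_1=1$ identifies it with the set of triples of pairwise distinct points of $\mathbb{H}$, and it is oriented by the complex orientation of $\mathbb{H}^3$. For $t\in\mathbb{R}$, an interior marked point $p$, and a marked point $s\neq p$, the Rossi–Willwacher propagator is the one-form $$\alpha^t_{p\to s}=\frac{1-t}{2\pi i}\,d\log\frac{p-s}{\overline p-s}+\frac{t}{2\pi i}\,d\log\frac{p-\overline s}{\overline p-\overline s}.$$ Let $\Gamma$ be the directed graph with internal vertices $x,y,z$, external vertices $0,1$, and the six edges, in this order, $y\to x$, $y\to 0$, $x\to y$, $x\to 1$, $z\to x$, $z\to 1$. **Proposition.** For every $t\in\mathbb{R}$ the integral of the form $$\omega_\Gamma^t=\alpha^t_{y\to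 x}\wedge\alpha^t_{y\to 0}\wedge\alpha^t_{x\to y}\wedge\alpha^t_{x\to 1}\wedge\alpha^t_{z\to x}\wedge\alpha^t_{z\to 1}$$ over $C_{\{x,y,z\},\{0,1\}}$ converges absolutely, and the weight of $\Gamma$ is $$c_\Gamma^t=\int_{C_{\{x,y,z\},\{0,1\}}}\omega_\Gamma^t=(1-2t)\,\frac{\zeta(3)}{(2\pi i)^3}.$$ -/

import Mathlib

/-!
# Weights of admissible graphs for the interpolating propagator

Marked disks are modelled by the closed upper half-plane with the special boundary marked point
at infinity.  Interior points are labelled by `Fin n`, boundary points by `Fin m` in increasing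
order.
-/

noncomputable section

namespace DiskWeights

/-! ## Configurations and the moduli space of marked disks -/

/-- The real vector space in which configurations of `n` interior points and `m` boundary points
live. -/
abbrev Points (n m : ℕ) : Type := (Fin n → ℂ) × (Fin m → ℝ)

/-- `Conf_n(ℍ)`: configurations of `n` distinct points in the open upper half-plane. -/
def interiorConf (n : ℕ) : Set (Fin n → ℂ) :=
  {z | (∀ p, 0 < (z p).im) ∧ Function.Injective z}

/-- `Conf_n(ℍ) × Conf_{m,+}(ℝ)`. -/
def conf (n m : ℕ) : Set (Points n m) :=
  {c | c.1 ∈ interiorConf n ∧ StrictMono c.2}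

/-- The map `w ↦ a w + b`, applied to all the points of a configuration. -/
def affineMove {n m : ℕ} (a b : ℝ) (c : Points n m) : Points n m :=
  (fun p => (a : ℂ) * c.1 p + (b : ℂ), fun q => a * c.2 q + b)

/-- Two configurations are equivalent if they differ by the action of the group
`G = ℝ_{>0} ⋉ ℝ` of conformal automorphisms of the closed half-plane fixing infinity. -/
def confSetoid (n m : ℕ) : Setoid (conf n m) where
  r c c' := ∃ a b : ℝ, 0 < a ∧ (c' : Points n m) = affineMove a b (c : Points n m)
  iseqv :=
    { refl := fun c => ⟨1, 0, one_pos, by ext <;> simp [affineMove]⟩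
      symm := by
        rintro c c' ⟨a, b, ha, h⟩
        refine ⟨a⁻¹, -(a⁻¹ * b), inv_pos.mpr ha, ?_⟩
        have ha' : a ≠ 0 := ha.ne'
        have hac : (a : ℂ) ≠ 0 := by exact_mod_cast ha'
        rw [h]
        refine Prod.ext (funext fun p => ?_) (funext fun q => ?_)
        · simp only [affineMove]; push_cast; field_simp; ring
        · simp only [affineMove]; field_simp; ring
      trans := by
        rintro c c' c'' ⟨a, b, ha, h⟩ ⟨a', b', ha', h'⟩
        refine ⟨a' * a, a' * b + b', mul_pos ha' ha, ?_⟩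
        rw [h', h]
        refine Prod.ext (funext fun p => ?_) (funext fun q => ?_)
        · simp only [affineMove]; push_cast; ring
        · simp only [affineMove]; ring }

/-- The moduli space `C_{n,m} = (Conf_n(ℍ) × Conf_{m,+}(ℝ)) / G` of marked disks. -/
def Moduli (n m : ℕ) : Type := Quotient (confSetoid n m)

/-- The configuration whose two boundary points are placed at `0` and `1`. -/
def normalized {n : ℕ} (z : Fin n → ℂ) : Points n 2 := (z, ![0, 1])

theorem normalized_mem_conf {n : ℕ} {z : Fin n → ℂ} (hz : z ∈ interiorConf n) :
    normalized z ∈ conf n 2 := by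
  refine ⟨hz, fun i j hij => ?_⟩
  fin_cases i <;> fin_cases j <;> simp_all [normalized]

/-- The global coordinates on `C_{n,2}`, in which the boundary points are `0` and `1`. -/
def chart (n : ℕ) (z : interiorConf n) : Moduli n 2 :=
  Quotient.mk (confSetoid n 2) ⟨normalized (z : Fin n → ℂ), normalized_mem_conf z.2⟩

/-- Every marked disk with two boundary points has a unique representative in which these are
`0` and `1`, so `C_{n,2}` is identified with `Conf_n(ℍ)`. -/
theorem chart_bijective (n : ℕ) : Function.Bijective (chart n) := by
  constructor
  · intro z w h
    obtain ⟨a, b, ha, h⟩ := Quotient.exact h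
    have h0 := congrFun (congrArg Prod.snd h) 0
    have h1 := congrFun (congrArg Prod.snd h) 1
    simp only [normalized, affineMove, Matrix.cons_val_zero, Matrix.cons_val_one] at h0 h1
    have hb : b = 0 := by linarith
    have ha1 : a = 1 := by linarith
    apply Subtype.ext
    funext p
    have hp := congrFun (congrArg Prod.fst h) p
    simp only [normalized, affineMove, hb, ha1] at hp
    simpa using hp.symm
  · intro u
    obtain ⟨⟨⟨z, r⟩, ⟨hz, hinj⟩, hr⟩, rfl⟩ := Quotient.exists_rep u
    have hlt : r 0 < r 1 := hr (by decide)
    have hd : 0 < r 1 - r 0 := by linarith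
    have hdc : ((r 1 : ℂ) - (r 0 : ℂ)) ≠ 0 := by
      have : ((r 1 - r 0 : ℝ) : ℂ) ≠ 0 := by exact_mod_cast hd.ne'
      simpa using this
    have hw : (fun p => (((r 1 - r 0)⁻¹ : ℝ) : ℂ) * (z p - (r 0 : ℂ))) ∈ interiorConf n := by
      refine ⟨fun p => ?_, fun p p' h => hinj ?_⟩
      · have := hz p
        rw [Complex.im_ofReal_mul]
        simp only [Complex.sub_im, Complex.ofReal_im, sub_zero]
        exact mul_pos (inv_pos.mpr hd) this
      · have hne : (((r 1 - r 0)⁻¹ : ℝ) : ℂ) ≠ 0 := by exact_mod_cast (inv_pos.mpr hd).ne'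
        have := mul_left_cancel₀ hne h
        exact sub_left_injective this
    refine ⟨⟨_, hw⟩, Quotient.sound ⟨r 1 - r 0, r 0, hd, ?_⟩⟩
    refine Prod.ext (funext fun p => ?_) (funext fun q => ?_)
    · simp only [normalized, affineMove]
      push_cast
      field_simp
      ring
    · fin_cases q <;> simp [normalized, affineMove]

/-! ## Propagators -/

/-- The position in `ℂ` of the vertex `s` (interior or boundary) of a configuration. -/
def position {n m : ℕ} (s : Fin n ⊕ Fin m) (c : Points n m) : ℂ :=
  Sum.elim c.1 (fun q => (c.2 q : ℂ)) s

/-- The cross ratio `(p - r)(q - s) / ((p - s)(q - r))` for `s = ∞`. -/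
def crossRatioInfty (p q r : ℂ) : ℂ := (p - r) / (q - r)

theorem crossRatioInfty_affine {a : ℂ} (ha : a ≠ 0) (b p q r : ℂ) :
    crossRatioInfty (a * p + b) (a * q + b) (a * r + b) = crossRatioInfty p q r := by
  have h1 : a * p + b - (a * r + b) = a * (p - r) := by ring
  have h2 : a * q + b - (a * r + b) = a * (q - r) := by ring
  rw [crossRatioInfty, crossRatioInfty, h1, h2, mul_div_mul_left _ _ ha]

/-- The cross ratio of `p`, `p̄`, `s`, `∞`, as a function of the configuration. -/
def ratio {n m : ℕ} (p : Fin n) (s : Fin n ⊕ Fin m) (c : Points n m) : ℂ :=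
  crossRatioInfty (c.1 p) (starRingEnd ℂ (c.1 p)) (position s c)

/-- The cross ratio of `p`, `p̄`, `s̄`, `∞`, as a function of the configuration. -/
def ratioConj {n m : ℕ} (p : Fin n) (s : Fin n ⊕ Fin m) (c : Points n m) : ℂ :=
  crossRatioInfty (c.1 p) (starRingEnd ℂ (c.1 p)) (starRingEnd ℂ (position s c))

theorem position_affineMove {n m : ℕ} (a b : ℝ) (s : Fin n ⊕ Fin m) (c : Points n m) :
    position s (affineMove a b c) = (a : ℂ) * position s c + (b : ℂ) := by
  cases s <;> simp [position, affineMove]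

/-- The cross ratios are `G`-invariant, hence functions on the moduli space. -/
theorem ratio_affineMove {n m : ℕ} {a : ℝ} (ha : 0 < a) (b : ℝ) (p : Fin n) (s : Fin n ⊕ Fin m)
    (c : Points n m) : ratio p s (affineMove a b c) = ratio p s c := by
  have hac : (a : ℂ) ≠ 0 := by exact_mod_cast ha.ne'
  have h := crossRatioInfty_affine hac b (c.1 p) (starRingEnd ℂ (c.1 p)) (position s c)
  rw [ratio, ratio, position_affineMove, ← h]
  simp [affineMove]

theorem ratioConj_affineMove {n m : ℕ} {a : ℝ} (ha : 0 < a) (b : ℝ) (p : Fin n)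
    (s : Fin n ⊕ Fin m) (c : Points n m) :
    ratioConj p s (affineMove a b c) = ratioConj p s c := by
  have hac : (a : ℂ) ≠ 0 := by exact_mod_cast ha.ne'
  have h := crossRatioInfty_affine hac b (c.1 p) (starRingEnd ℂ (c.1 p))
    (starRingEnd ℂ (position s c))
  rw [ratioConj, ratioConj, position_affineMove, ← h]
  simp [affineMove]

/-- The logarithmic differential `d log f = df / f` of a complex-valued function on a real vector
space, at the point `c`. -/
def dlog {V : Type*} [NormedAddCommGroup V] [NormedSpace ℝ V] (f : V → ℂ) (c : V) : V →L[ℝ] ℂ :=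
  (f c)⁻¹ • fderiv ℝ f c

/-- The one-form `α^t_{p → s}` of the interpolating family, at the configuration `c`.  It is built
from `G`-invariant functions, and so descends to the moduli space. -/
def propagator {n m : ℕ} (t : ℝ) (p : Fin n) (s : Fin n ⊕ Fin m) (c : Points n m) :
    Points n m →L[ℝ] ℂ :=
  ((1 - (t : ℂ)) / (2 * (Real.pi : ℂ) * Complex.I)) • dlog (ratio p s) c +
    ((t : ℂ) / (2 * (Real.pi : ℂ) * Complex.I)) • dlog (ratioConj p s) c

/-! ## Admissible graphs and their forms -/

/-- An admissible graph of type `(n,m)` with `k = 2n + m - 2` ordered edges.  All edges start at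
interior vertices, so that the external vertices are sinks. -/
structure AdmissibleGraph (n m k : ℕ) where
  source : Fin k → Fin n
  target : Fin k → Fin n ⊕ Fin m
  edge_count : k + 2 = 2 * n + m
  no_loop : ∀ e, target e ≠ Sum.inl (source e)
  no_parallel : Function.Injective fun e => (source e, target e)

/-- The wedge product `α 0 ∧ ⋯ ∧ α (k-1)` of real-linear complex-valued one-forms, that is
`(v 0, …, v (k-1)) ↦ det (α i (v j))`. -/
def wedge {V : Type*} [NormedAddCommGroup V] [NormedSpace ℝ V] {k : ℕ}
    (α : Fin k → V →L[ℝ] ℂ) : V [⋀^Fin k]→ₗ[ℝ] ℂ where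
  toFun v := Matrix.det (Matrix.of fun i j => α i (v j))
  map_update_add' := by
    intro inst v j x y
    obtain rfl : inst = instDecidableEqFin k := Subsingleton.elim _ _
    have key : ∀ u : V, Matrix.det (Matrix.of fun i j' => α i (Function.update v j u j')) =
        Matrix.det ((Matrix.of fun i j' => α i (v j')).updateCol j (fun i => α i u)) := by
      intro u
      congr 1
      ext i j'
      by_cases h : j' = j
      · subst h; simp
      · simp [h]
    rw [key, key, key, ← Matrix.det_updateCol_add]
    congr 2
    funext i
    simp
  map_update_smul' := by
    intro inst v j r x
    obtain rfl : inst = instDecidableEqFin k := Subsingleton.elim _ _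
    have key : ∀ u : V, Matrix.det (Matrix.of fun i j' => α i (Function.update v j u j')) =
        Matrix.det ((Matrix.of fun i j' => α i (v j')).updateCol j (fun i => α i u)) := by
      intro u
      congr 1
      ext i j'
      by_cases h : j' = j
      · subst h; simp
      · simp [h]
    rw [key, key, Complex.real_smul, ← Matrix.det_updateCol_smul]
    congr 2
    funext i
    simp
  map_eq_zero_of_eq' := by
    intro v i j hij hne
    exact Matrix.det_zero_of_column_eq hne fun l => by simp [hij]

/-- The form `ω_Γ^t = ⋀_e α_e^t`, with the factors in the order of the edges. -/
def graphForm {n m k : ℕ} (Γ : AdmissibleGraph n m k) (t : ℝ) (c : Points n m) :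
    Points n m [⋀^Fin k]→ₗ[ℝ] ℂ :=
  wedge fun e => propagator t (Γ.source e) (Γ.target e) c

/-! ## Integration over `C_{n,2}` -/

/-- The frame `∂/∂(Re z₀), ∂/∂(Im z₀), ∂/∂(Re z₁), ∂/∂(Im z₁), …` of `ℂⁿ`, which is positive for
the complex orientation. -/
def frame (n : ℕ) (j : Fin (n * 2)) : Fin n → ℂ :=
  Pi.single (finProdFinEquiv.symm j).1 (![1, Complex.I] (finProdFinEquiv.symm j).2)

/-- The coefficient, relative to `d(Re z₀) ∧ d(Im z₀) ∧ d(Re z₁) ∧ ⋯`, of the pullback of a form of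
top degree to the coordinates `z` on `C_{n,2}`. -/
def chartDensity {n : ℕ} (ω : (c : Points n 2) → Points n 2 [⋀^Fin (n * 2)]→ₗ[ℝ] ℂ)
    (z : Fin n → ℂ) : ℂ :=
  ω (normalized z) fun j => fderiv ℝ normalized z (frame n j)

/-- Absolute convergence of the integral of a form of top degree over `C_{n,2}`. -/
def ModuliIntegrable {n : ℕ} (ω : (c : Points n 2) → Points n 2 [⋀^Fin (n * 2)]→ₗ[ℝ] ℂ) : Prop :=
  MeasureTheory.IntegrableOn (chartDensity ω) (interiorConf n) MeasureTheory.volume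

/-- The integral of a form of top degree over `C_{n,2}` with its canonical orientation, in the
coordinates `z` provided by `chart`. -/
def moduliIntegral {n : ℕ} (ω : (c : Points n 2) → Points n 2 [⋀^Fin (n * 2)]→ₗ[ℝ] ℂ) : ℂ :=
  ∫ z in interiorConf n, chartDensity ω z

/-- The weight `c_Γ^t` of an admissible graph of type `(n,2)`. -/
def weight {n : ℕ} (Γ : AdmissibleGraph n 2 (n * 2)) (t : ℝ) : ℂ :=
  moduliIntegral (graphForm Γ t)

/-! ## The graph with edges `yx, y0, xy, x1, zx, z1` -/

/-- The graph of type `(3,2)` with interior vertices `x = 0`, `y = 1`, `z = 2`, external vertices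
`0` and `1`, and the ordered edges `y → x`, `y → 0`, `x → y`, `x → 1`, `z → x`, `z → 1`. -/
def zetaGraph : AdmissibleGraph 3 2 (3 * 2) where
  source := ![1, 1, 0, 0, 2, 2]
  target := ![Sum.inl 0, Sum.inr 0, Sum.inl 1, Sum.inr 1, Sum.inl 0, Sum.inr 1]
  edge_count := by norm_num
  no_loop := by decide
  no_parallel := by decide

end DiskWeights

end

open MeasureTheory Set Filter Topology Complex
open scoped ENNReal
noncomputable section
namespace DiskWeights

/-! The vertex `z` is joined only to `x` and `1`, so the density of the form factors as `pairDensity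
t x y * forkDensity t x z` (`chartDensity_zetaGraph`). For fixed `x` the integrals over `y` and `z`
are then independent, and what remains is an integral over `x`.

Complex conjugation exchanges the two halves of the propagator up to sign. The density is therefore
determined by its value at `t = 0`: the fork part is `(1 - t) K - t conj K` and the pair part is `(1
- t) F + t conj F`. For the pair part this includes a cancellation that makes a quadratic polynomial
in `t` affine (`pair_coefficient_identity`).

Both inner integrals are done in polar coordinates. Along a ray the integrand is a rational function
of the radius with simple poles off the positive half-line, so its integral is a combination of
logarithms (`integral_Ioi_partialFractions`). Integrating over the angle gives: * for `z`, the value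
`arg (x - 1) / π - 1 / 2`. It does not depend on `t`, because the integral of `K` is purely
imaginary (`integral_forkDensity`). * for `y`, with `φ = arg x`, the value `(π log (2 sin φ) + i (π²
/ 2 - π φ)) / |x|²` (`integral_pairKernel`). Inside `F` it is multiplied by a purely imaginary
factor, so in `(1 - t) F + t conj F` the logarithm acquires the factor `1 - 2t` and the other term
keeps the factor `1`.

For `x = ρ exp (iφ)` the integral over `ρ` has an elementary primitive and equals `φ (π - φ) / (2 π
sin φ)` (`integral_arg_div_normSq`). In the last integral, over `φ`, the term `π² / 2 - π φ` is odd
about `π / 2` and contributes zero. The logarithm contributes `∫ φ (π - φ) log (2 sin φ) dφ = (π /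
2) ζ(3)`, by pairing the Fourier series of the two factors (`integral_mul_log_two_mul_sin`).

Absolute convergence comes from bounding the kernels by products `‖v‖ ^ (-a) * ‖v - u‖ ^ (-b)` with
`a, b < 2 < a + b`, whose integrals scale as powers of `‖u‖`. -/

/-! ### Polar coordinates on the upper half-plane. -/

/-- The open upper half-plane as a subset of `ℂ`. -/
def upperHalf : Set ℂ := {z | 0 < z.im}

theorem measurableSet_upperHalf : MeasurableSet upperHalf :=
  measurableSet_lt measurable_const Complex.measurable_im

theorem polar_mem_upperHalf_iff {r θ : ℝ} (hr : 0 < r) (hθ : θ ∈ Ioo (-Real.pi) Real.pi) :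
    (r : ℂ) * exp (θ * I) ∈ upperHalf ↔ θ ∈ Ioo 0 Real.pi := by
  have him : ((r : ℂ) * exp (θ * I)).im = r * Real.sin θ := by
    rw [Complex.im_ofReal_mul, Complex.exp_ofReal_mul_I_im]
  simp only [upperHalf, mem_ofPred_eq, him]
  constructor
  · intro h
    refine ⟨?_, hθ.2⟩
    by_contra h0
    have := Real.sin_nonpos_of_nonpos_of_neg_pi_le (not_lt.mp h0) hθ.1.le
    nlinarith
  · intro h
    exact mul_pos hr (Real.sin_pos_of_pos_of_lt_pi h.1 h.2)

theorem polarCoord_symm_eq_exp (p : ℝ × ℝ) :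
    Complex.polarCoord.symm p = (p.1 : ℂ) * exp (p.2 * I) := by
  rw [Complex.polarCoord_symm_apply, Complex.exp_mul_I]
  simp

/-- Polar coordinates on the upper half-plane: integrability. -/
theorem integrable_polar_upperHalf {f : ℂ → ℂ} (hm : Measurable f)
    (hf : IntegrableOn f upperHalf) :
    IntegrableOn (fun p : ℝ × ℝ => (p.1 : ℂ) * f (p.1 * exp (p.2 * I)))
      (Ioi (0 : ℝ) ×ˢ Ioo 0 Real.pi) := by
  refine ⟨?_, ?_⟩
  · apply Measurable.aestronglyMeasurable
    fun_prop
  · have h := hf.2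
    rw [hasFiniteIntegral_iff_enorm] at h ⊢
    rw [← lintegral_indicator measurableSet_upperHalf,
      ← Complex.lintegral_comp_polarCoord_symm] at h
    refine lt_of_le_of_lt ?_ h
    have hsub : Ioi (0 : ℝ) ×ˢ Ioo 0 Real.pi ⊆ polarCoord.target := by
      rw [polarCoord_target]
      exact prod_mono le_rfl (Ioo_subset_Ioo (by linarith [Real.pi_pos]) le_rfl)
    refine le_trans ?_ (lintegral_mono_set hsub)
    refine setLIntegral_mono' (measurableSet_Ioi.prod measurableSet_Ioo) fun p hp => ?_
    have hp1 : 0 < p.1 := hp.1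
    have hθ : p.2 ∈ Ioo (-Real.pi) Real.pi := ⟨by linarith [hp.2.1, Real.pi_pos], hp.2.2⟩
    rw [polarCoord_symm_eq_exp,
      indicator_of_mem ((polar_mem_upperHalf_iff hp1 hθ).2 hp.2), enorm_mul, smul_eq_mul]
    gcongr
    rw [← ofReal_norm, Complex.norm_real, Real.norm_of_nonneg hp1.le]

/-- Polar coordinates on the upper half-plane. -/
theorem integral_polar_upperHalf {f : ℂ → ℂ} (hm : Measurable f)
    (hf : IntegrableOn f upperHalf) :
    ∫ z in upperHalf, f z =
      ∫ θ in Ioo 0 Real.pi, ∫ r in Ioi (0 : ℝ), (r : ℂ) * f (r * exp (θ * I)) := by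
  have h1 := integrable_polar_upperHalf hm hf
  rw [← integral_indicator measurableSet_upperHalf, ← Complex.integral_comp_polarCoord_symm]
  have h2 : ∫ p in polarCoord.target,
      p.1 • upperHalf.indicator f (Complex.polarCoord.symm p) =
      ∫ p in polarCoord.target, (Ioi (0 : ℝ) ×ˢ Ioo 0 Real.pi).indicator
        (fun p : ℝ × ℝ => (p.1 : ℂ) * f (p.1 * exp (p.2 * I))) p := by
    refine setIntegral_congr_fun polarCoord.open_target.measurableSet fun p hp => ?_
    rw [polarCoord_target] at hp
    simp only [polarCoord_symm_eq_exp]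
    by_cases h : p.2 ∈ Ioo 0 Real.pi
    · rw [indicator_of_mem ((polar_mem_upperHalf_iff hp.1 hp.2).2 h),
        indicator_of_mem (mk_mem_prod hp.1 h)]
      rw [Complex.real_smul]
    · rw [indicator_of_notMem (fun h' => h ((polar_mem_upperHalf_iff hp.1 hp.2).1 h')),
        indicator_of_notMem (fun h' => h h'.2), smul_zero]
  have hsub : Ioi (0 : ℝ) ×ˢ Ioo 0 Real.pi ⊆ polarCoord.target := by
    rw [polarCoord_target]
    exact prod_mono le_rfl (Ioo_subset_Ioo (by linarith [Real.pi_pos]) le_rfl)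
  rw [h2, setIntegral_indicator (measurableSet_Ioi.prod measurableSet_Ioo),
    inter_eq_self_of_subset_right hsub]
  rw [Measure.volume_eq_prod] at h1 ⊢
  rw [← setIntegral_prod_swap, setIntegral_prod]
  · rfl
  · exact h1.swap

/-! ### Half-line integrals of rational functions with simple poles. -/

/-- Moving to the right never enters the cut, so the principal logarithm is a primitive of `1 / (r +
a)` along the whole half-line. -/
theorem add_mem_slitPlane_of_nonneg {a : ℂ} (ha : a ∈ slitPlane) {r : ℝ} (hr : 0 ≤ r) :
    (r : ℂ) + a ∈ slitPlane := by
  rw [mem_slitPlane_iff] at ha ⊢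
  simp only [add_re, ofReal_re, add_im, ofReal_im, zero_add]
  rcases ha with h | h
  · left; linarith
  · right; exact h

theorem hasDerivAt_log_ofReal_add {a : ℂ} {r : ℝ} (h : (r : ℂ) + a ∈ slitPlane) :
    HasDerivAt (fun r : ℝ => log ((r : ℂ) + a)) (1 / ((r : ℂ) + a)) r := by
  have h1 : HasDerivAt (fun r : ℝ => (r : ℂ) + a) 1 r :=
    (Complex.ofRealCLM.hasDerivAt (x := r)).add_const a
  exact h1.clog_real h

/-- The integral over the positive half-line of a rational function with simple poles, given by
its partial fraction decomposition. -/
theorem integral_Ioi_partialFractions {ι : Type*} [Fintype ι] {c a : ι → ℂ} (hc : ∑ i, c i = 0)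
    (ha : ∀ i, -a i ∈ slitPlane)
    (hint : IntegrableOn (fun r : ℝ => ∑ i, c i / ((r : ℂ) - a i)) (Ioi 0)) :
    ∫ r in Ioi (0 : ℝ), ∑ i, c i / ((r : ℂ) - a i) = -∑ i, c i * log (-a i) := by
  -- Each logarithm is `log r` plus `log (1 - a i / r)`; the divergent parts cancel because the
  -- residues sum to zero.
  have hlim : Tendsto (fun r : ℝ => ∑ i, c i * log ((r : ℂ) + -a i)) atTop (𝓝 0) := by
    have h1 : Tendsto (fun r : ℝ => ∑ i, c i * log (1 + ((r⁻¹ : ℝ) : ℂ) * -a i)) atTop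
        (𝓝 (∑ i, c i * log (1 + ((0 : ℝ) : ℂ) * -a i))) := by
      refine tendsto_finsetSum _ fun i _ => Tendsto.const_mul _ ?_
      refine (Tendsto.clog ?_ (by simp))
      exact (((Complex.continuous_ofReal.tendsto _).comp tendsto_inv_atTop_zero).mul_const
        (-a i)).const_add 1
    simp only [ofReal_zero, zero_mul, add_zero, log_one, mul_zero, Finset.sum_const_zero] at h1
    refine h1.congr' ?_
    filter_upwards [eventually_gt_atTop 0] with r hr
    have hr' : (r : ℂ) ≠ 0 := by exact_mod_cast hr.ne'
    have h2 : ∀ i, log ((r : ℂ) + -a i) =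
        (Real.log r : ℂ) + log (1 + ((r⁻¹ : ℝ) : ℂ) * -a i) := by
      intro i
      have h3 : (r : ℂ) + -a i = (r : ℂ) * (1 + ((r⁻¹ : ℝ) : ℂ) * -a i) := by
        push_cast; field_simp
      have h4 : (r : ℂ) + -a i ≠ 0 :=
        slitPlane_ne_zero (add_mem_slitPlane_of_nonneg (ha i) hr.le)
      rw [h3] at h4 ⊢
      rw [Complex.log_ofReal_mul hr (right_ne_zero_of_mul h4)]
    simp only [h2, mul_add, Finset.sum_add_distrib, ← Finset.sum_mul, hc, zero_mul, zero_add]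
  have h := integral_Ioi_of_hasDerivAt_of_tendsto' (a := (0 : ℝ))
    (f := fun r : ℝ => ∑ i, c i * log ((r : ℂ) + -a i))
    (f' := fun r : ℝ => ∑ i, c i / ((r : ℂ) - a i)) (m := 0) ?_ hint hlim
  · rw [h]; simp
  · intro r hr
    have h1 : HasDerivAt (fun r : ℝ => ∑ i, c i * log ((r : ℂ) + -a i))
        (∑ i, c i * (1 / ((r : ℂ) + -a i))) r := by
      refine HasDerivAt.fun_sum fun i _ => HasDerivAt.const_mul _ ?_
      exact hasDerivAt_log_ofReal_add (add_mem_slitPlane_of_nonneg (ha i) hr)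
    have h2 : ∑ i, c i / ((r : ℂ) - a i) = ∑ i, c i * (1 / ((r : ℂ) + -a i)) :=
      Finset.sum_congr rfl fun i _ => by rw [← sub_eq_add_neg, mul_one_div]
    rw [h2]; exact h1

/-! ### Principal logarithms of points in polar form. -/

theorem ofReal_mul_exp_eq_exp {ρ : ℝ} (hρ : 0 < ρ) (α : ℝ) :
    (ρ : ℂ) * exp (α * I) = exp ((Real.log ρ : ℝ) + α * I) := by
  rw [Complex.exp_add, ← Complex.ofReal_exp, Real.exp_log hρ]

theorem log_ofReal_mul_exp {ρ : ℝ} (hρ : 0 < ρ) {α : ℝ} (h : α ∈ Ioo (-Real.pi) Real.pi) :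
    log ((ρ : ℂ) * exp (α * I)) = Real.log ρ + α * I := by
  rw [ofReal_mul_exp_eq_exp hρ, Complex.log_exp] <;> simp [h.1, h.2.le]

theorem ofReal_mul_exp_mem_slitPlane {ρ : ℝ} (hρ : 0 < ρ) {α : ℝ}
    (h : α ∈ Ioo (-Real.pi) Real.pi) : (ρ : ℂ) * exp (α * I) ∈ slitPlane := by
  rw [mem_slitPlane_iff_arg]
  constructor
  · have h1 := congrArg Complex.im (log_ofReal_mul_exp hρ h)
    rw [Complex.log_im] at h1
    simp only [add_im, ofReal_im, mul_im, ofReal_re, I_im, mul_one, I_re, mul_zero, add_zero,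
      zero_add] at h1
    rw [h1]; exact h.2.ne
  · rw [ofReal_mul_exp_eq_exp hρ]; exact Complex.exp_ne_zero _

theorem neg_ofReal_mul_exp_sub (ρ α : ℝ) :
    -((ρ : ℂ) * exp (α * I)) = ρ * exp ((α - Real.pi : ℝ) * I) := by
  have : ((α - Real.pi : ℝ) : ℂ) * I = α * I - Real.pi * I := by push_cast; ring
  rw [this, Complex.exp_sub, Complex.exp_pi_mul_I]; ring

theorem neg_ofReal_mul_exp_add (ρ α : ℝ) :
    -((ρ : ℂ) * exp (α * I)) = ρ * exp ((α + Real.pi : ℝ) * I) := by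
  have : ((α + Real.pi : ℝ) : ℂ) * I = α * I + Real.pi * I := by push_cast; ring
  rw [this, Complex.exp_add, Complex.exp_pi_mul_I]; ring

/-- The argument of `-exp (i (φ - θ))` for distinct angles `φ`, `θ` between `0` and `π`. -/
def angleJump (φ θ : ℝ) : ℝ := if θ < φ then φ - θ - Real.pi else φ - θ + Real.pi

theorem neg_polar_angleJump (ρ φ θ : ℝ) :
    -((ρ : ℂ) * exp ((φ - θ : ℝ) * I)) = ρ * exp (angleJump φ θ * I) := by
  unfold angleJump
  split_ifs
  · exact neg_ofReal_mul_exp_sub _ _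
  · exact neg_ofReal_mul_exp_add _ _

theorem angleJump_mem {φ θ : ℝ} (hφ : φ ∈ Ioo 0 Real.pi) (hθ : θ ∈ Ioo 0 Real.pi) (h : θ ≠ φ) :
    angleJump φ θ ∈ Ioo (-Real.pi) Real.pi := by
  obtain ⟨h1, h2⟩ := hφ
  obtain ⟨h3, h4⟩ := hθ
  unfold angleJump
  split_ifs with h5
  · constructor <;> linarith
  · have : φ < θ := lt_of_le_of_ne (not_lt.mp h5) h.symm
    constructor <;> linarith

theorem integral_const_sub_id (a b c : ℝ) :
    ∫ x in a..b, (c - x) = c * (b - a) - (b ^ 2 - a ^ 2) / 2 := by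
  rw [intervalIntegral.integral_sub (by simp) (by simp)]
  simp
  ring

theorem integral_angleJump {φ : ℝ} (hφ : φ ∈ Ioo 0 Real.pi) :
    IntegrableOn (angleJump φ) (Ioo 0 Real.pi) ∧
    ∫ θ in Ioo 0 Real.pi, angleJump φ θ = Real.pi ^ 2 / 2 - Real.pi * φ := by
  have e1 : EqOn (angleJump φ) (fun θ => (φ - Real.pi) - θ) (Ioo 0 φ) := fun θ h => by
    simp only [angleJump, if_pos h.2]; ring
  have e2 : EqOn (angleJump φ) (fun θ => (φ + Real.pi) - θ) (Ico φ Real.pi) := fun θ h => by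
    simp only [angleJump, if_neg (not_lt.mpr h.1)]; ring
  have hu : Ioo 0 Real.pi = Ioo 0 φ ∪ Ico φ Real.pi := (Ioo_union_Ico_eq_Ioo hφ.1 hφ.2.le).symm
  have hd : Disjoint (Ioo 0 φ) (Ico φ Real.pi) :=
    Set.disjoint_left.2 fun x h1 h2 => absurd h1.2 (not_lt.2 h2.1)
  have i1 : IntegrableOn (angleJump φ) (Ioo 0 φ) :=
    (integrableOn_congr_fun e1 measurableSet_Ioo).2
      ((Continuous.integrableOn_Icc (by fun_prop)).mono_set Ioo_subset_Icc_self)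
  have i2 : IntegrableOn (angleJump φ) (Ico φ Real.pi) :=
    (integrableOn_congr_fun e2 measurableSet_Ico).2
      ((Continuous.integrableOn_Icc (by fun_prop)).mono_set Ico_subset_Icc_self)
  refine ⟨by rw [hu]; exact i1.union i2, ?_⟩
  rw [hu, setIntegral_union hd measurableSet_Ico i1 i2,
    setIntegral_congr_fun measurableSet_Ioo e1, setIntegral_congr_fun measurableSet_Ico e2,
    ← integral_Ioc_eq_integral_Ioo, integral_Ico_eq_integral_Ioo, ← integral_Ioc_eq_integral_Ioo,
    ← intervalIntegral.integral_of_le hφ.1.le, ← intervalIntegral.integral_of_le hφ.2.le,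
    integral_const_sub_id, integral_const_sub_id]
  ring

theorem ae_ne_of_restrict (s : Set ℝ) (a : ℝ) : ∀ᵐ θ ∂(volume.restrict s), θ ≠ a := by
  refine ae_restrict_of_ae ?_
  exact (measure_eq_zero_iff_ae_notMem.1 (Real.volume_singleton (a := a))).mono fun x hx => hx

/-! ### Integrating the fork kernel. -/

/-- The kernel obtained by integrating out a vertex with edges to `u` and to the boundary point
`0`. -/
def forkKernel (u v : ℂ) : ℂ :=
  u * (v - starRingEnd ℂ v) /
    ((v - u) * (starRingEnd ℂ v - u) * (v * starRingEnd ℂ v))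

@[fun_prop]
theorem measurable_forkKernel (u : ℂ) : Measurable (forkKernel u) := by
  unfold forkKernel; fun_prop

theorem conj_exp_mul_I (θ : ℝ) : starRingEnd ℂ (exp (θ * I)) = exp (-(θ * I)) := by
  rw [← Complex.exp_conj]; simp

/-- The poles in `r` come from `v̄ = u` and `v = u`. The Jacobian and the factor `r` of `v - v̄`
cancel `v v̄ = r²`, so there is no pole at the origin. -/
theorem forkKernel_polar {ρ φ θ r : ℝ} (hρ : 0 < ρ) (hφ : φ ∈ Ioo 0 Real.pi)
    (hθ : θ ∈ Ioo 0 Real.pi) (hne : θ ≠ φ) (hr : 0 < r) :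
    (r : ℂ) * forkKernel (ρ * exp (φ * I)) (r * exp (θ * I)) =
      1 / ((r : ℂ) - ρ * exp ((φ + θ : ℝ) * I)) - 1 / ((r : ℂ) - ρ * exp ((φ - θ : ℝ) * I)) := by
  have hr0 : (r : ℂ) ≠ 0 := by exact_mod_cast hr.ne'
  have n1 : (r : ℂ) - ρ * exp ((φ + θ : ℝ) * I) ≠ 0 := by
    have := slitPlane_ne_zero (add_mem_slitPlane_of_nonneg
      (ofReal_mul_exp_mem_slitPlane hρ (α := φ + θ - Real.pi)
        ⟨by linarith [hφ.1, hθ.1], by linarith [hφ.2, hθ.2]⟩) hr.le)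
    rwa [← neg_ofReal_mul_exp_sub, ← sub_eq_add_neg] at this
  have n2 : (r : ℂ) - ρ * exp ((φ - θ : ℝ) * I) ≠ 0 := by
    have := slitPlane_ne_zero (add_mem_slitPlane_of_nonneg
      (ofReal_mul_exp_mem_slitPlane hρ (angleJump_mem hφ hθ hne)) hr.le)
    rwa [← neg_polar_angleJump, ← sub_eq_add_neg] at this
  have hA : exp ((φ + θ : ℝ) * I) = exp (φ * I) * exp (θ * I) := by
    rw [← Complex.exp_add]; push_cast; ring_nf
  have hB : exp ((φ - θ : ℝ) * I) = exp (φ * I) * exp (-(θ * I)) := by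
    rw [← Complex.exp_add]; push_cast; ring_nf
  have hw : exp (θ * I) * exp (-(θ * I)) = 1 := by rw [← Complex.exp_add]; simp
  rw [hA] at n1 ⊢
  rw [hB] at n2 ⊢
  simp only [forkKernel, map_mul, conj_exp_mul_I, conj_ofReal]
  have w0 := Complex.exp_ne_zero (θ * I)
  have w1 := Complex.exp_ne_zero (-(θ * I))
  generalize exp (θ * I) = w at *
  generalize exp (-(θ * I)) = w' at *
  generalize exp (φ * I) = e at *
  have hX1 : (r : ℂ) * w - ρ * e = w * (r - ρ * (e * w')) := by linear_combination ρ * e * hw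
  have hX2 : (r : ℂ) * w' - ρ * e = w' * (r - ρ * (e * w)) := by linear_combination ρ * e * hw
  rw [hX1, hX2, div_sub_div _ _ n1 n2,
    show w * (r - ρ * (e * w')) * (w' * (r - ρ * (e * w))) * (r * w * (r * w')) =
      (w * w') ^ 2 * (r ^ 2 * ((r - ρ * (e * w')) * (r - ρ * (e * w)))) by ring, hw]
  field_simp
  ring

/-- The residues are `1` and `-1`, so `log ρ` drops out and only the difference of the two arguments
`angleJump φ θ` and `φ + θ - π` is left to integrate over `θ`. The ray `θ = φ` passes through the
pole and is discarded as a null set. -/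
theorem integral_forkKernel {ρ φ : ℝ} (hρ : 0 < ρ) (hφ : φ ∈ Ioo 0 Real.pi)
    (hint : IntegrableOn (forkKernel (ρ * exp (φ * I))) upperHalf) :
    ∫ v in upperHalf, forkKernel (ρ * exp (φ * I)) v =
      I * (Real.pi * (Real.pi - 2 * φ) : ℝ) := by
  rw [integral_polar_upperHalf (by fun_prop) hint]
  have hp := integrable_polar_upperHalf (by fun_prop) hint
  rw [IntegrableOn, Measure.volume_eq_prod, ← Measure.prod_restrict] at hp
  have hp' := hp.prod_left_ae
  have key : ∀ᵐ θ : ℝ ∂(volume.restrict (Ioo 0 Real.pi)),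
      ∫ r in Ioi (0 : ℝ), (r : ℂ) * forkKernel (ρ * exp (φ * I)) (r * exp (θ * I)) =
        ((angleJump φ θ - (φ + θ - Real.pi) : ℝ) : ℂ) * I := by
    filter_upwards [hp', ae_restrict_mem measurableSet_Ioo, ae_ne_of_restrict _ φ]
      with θ hi hθ hne
    have heq : EqOn (fun r : ℝ => (r : ℂ) * forkKernel (ρ * exp (φ * I)) (r * exp (θ * I)))
        (fun r : ℝ => ∑ i : Fin 2, (![1, -1] : Fin 2 → ℂ) i / ((r : ℂ) -
          (![ρ * exp ((φ + θ : ℝ) * I), ρ * exp ((φ - θ : ℝ) * I)] : Fin 2 → ℂ) i))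
        (Ioi 0) := by
      intro r hr
      simp only [forkKernel_polar hρ hφ hθ hne hr, Fin.sum_univ_two, Matrix.cons_val_zero,
        Matrix.cons_val_one]
      ring
    have hα : φ + θ - Real.pi ∈ Ioo (-Real.pi) Real.pi :=
      ⟨by linarith [hφ.1, hθ.1], by linarith [hφ.2, hθ.2]⟩
    rw [setIntegral_congr_fun measurableSet_Ioi heq, integral_Ioi_partialFractions (by simp)]
    · simp only [Fin.sum_univ_two, Matrix.cons_val_zero, Matrix.cons_val_one]
      rw [neg_ofReal_mul_exp_sub, neg_polar_angleJump, log_ofReal_mul_exp hρ hα,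
        log_ofReal_mul_exp hρ (angleJump_mem hφ hθ hne)]
      push_cast; ring
    · refine Fin.forall_fin_two.2 ⟨?_, ?_⟩
      · simp only [Matrix.cons_val_zero]
        rw [neg_ofReal_mul_exp_sub]; exact ofReal_mul_exp_mem_slitPlane hρ hα
      · simp only [Matrix.cons_val_one, Matrix.cons_val_zero]
        rw [neg_polar_angleJump]
        exact ofReal_mul_exp_mem_slitPlane hρ (angleJump_mem hφ hθ hne)
    · exact (integrableOn_congr_fun heq measurableSet_Ioi).1 hi
  rw [integral_congr_ae key, integral_mul_const, integral_complex_ofReal,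
    integral_sub (integral_angleJump hφ).1
      ((Continuous.integrableOn_Icc (by fun_prop)).mono_set Ioo_subset_Icc_self),
    (integral_angleJump hφ).2]
  have : ∫ θ in Ioo 0 Real.pi, (φ + θ - Real.pi) = Real.pi * φ - Real.pi ^ 2 / 2 := by
    rw [← integral_Ioc_eq_integral_Ioo, ← intervalIntegral.integral_of_le Real.pi_pos.le,
      intervalIntegral.integral_sub (Continuous.intervalIntegrable (by fun_prop) _ _) (by simp),
      intervalIntegral.integral_add (by simp) (by simp)]
    simp
    ring
  rw [this]
  push_cast; ring

/-! ### Integrals of the logarithm of the sine, and `ζ(3)`. -/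

theorem intervalIntegrable_log_sin' (a b : ℝ) :
    IntervalIntegrable (fun x => Real.log (Real.sin x)) volume a b :=
  intervalIntegrable_log_sin

theorem integral_log_sin_period (a : ℝ) :
    ∫ x in (a - Real.pi)..a, Real.log (Real.sin x) = -Real.log 2 * Real.pi := by
  -- `Real.log` is even, so `Real.log (Real.sin x)` means `log |sin x|` and has period `π`, not only
  -- `2π`.
  have hper : Function.Periodic (fun x => Real.log (Real.sin x)) Real.pi := fun x => by
    simp [Real.sin_add_pi]
  have := hper.intervalIntegral_add_eq (a - Real.pi) 0
  rw [sub_add_cancel, zero_add] at this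
  rw [this, integral_log_sin_zero_pi]

/-- The right-hand side is visibly continuous across `0`, since `sinc` is positive on the interval
and `x log x` is continuous. -/
theorem mul_log_sin_eq {x : ℝ} (hx : x ∈ Ioo (-Real.pi) Real.pi) :
    x * Real.log (Real.sin x) = x * Real.log x + x * Real.log (Real.sinc x) := by
  rcases eq_or_ne x 0 with rfl | h0
  · simp
  have hs : Real.sin x = x * Real.sinc x := by rw [Real.sinc_of_ne_zero h0]; field_simp
  have hs0 : Real.sin x ≠ 0 := by
    rcases lt_or_gt_of_ne h0 with h | h
    · exact (Real.sin_neg_of_neg_of_neg_pi_lt h hx.1).ne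
    · exact (Real.sin_pos_of_pos_of_lt_pi h hx.2).ne'
  rw [hs] at hs0 ⊢
  rw [Real.log_mul h0 (right_ne_zero_of_mul hs0)]
  ring

theorem sinc_pos {x : ℝ} (hx : x ∈ Ioo (-Real.pi) Real.pi) : 0 < Real.sinc x := by
  rcases lt_trichotomy x 0 with h | rfl | h
  · rw [Real.sinc_of_ne_zero h.ne]
    exact div_pos_of_neg_of_neg (Real.sin_neg_of_neg_of_neg_pi_lt h hx.1) h
  · simp
  · rw [Real.sinc_of_ne_zero h.ne']
    exact div_pos (Real.sin_pos_of_pos_of_lt_pi h hx.2) h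

theorem intervalIntegrable_mul_cot {φ : ℝ} (hφ : φ ∈ Ioo 0 Real.pi) :
    IntervalIntegrable (fun x => x * (Real.cos x / Real.sin x)) volume (φ - Real.pi) φ := by
  have hsub : uIcc (φ - Real.pi) φ ⊆ Ioo (-Real.pi) Real.pi := by
    rw [uIcc_of_le (by linarith [Real.pi_pos])]
    exact fun x hx => ⟨by linarith [hx.1, hφ.1], by linarith [hx.2, hφ.2]⟩
  have h : IntervalIntegrable (fun x => Real.cos x / Real.sinc x) volume (φ - Real.pi) φ := by
    apply ContinuousOn.intervalIntegrable
    exact Real.continuous_cos.continuousOn.div Real.continuous_sinc.continuousOn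
      fun x hx => (sinc_pos (hsub hx)).ne'
  refine h.congr_ae ?_
  filter_upwards [ae_ne_of_restrict _ 0] with x hx
  rw [Real.sinc_of_ne_zero hx]
  field_simp

/-- Integration by parts with primitive `x log |sin x|`, continuous at the exceptional point `0`.
The boundary terms give `π log (sin φ)`, and the integral of `log |sin x|` over a full period gives
`π log 2`. -/
theorem integral_mul_cot {φ : ℝ} (hφ : φ ∈ Ioo 0 Real.pi) :
    ∫ x in (φ - Real.pi)..φ, x * (Real.cos x / Real.sin x) =
      Real.pi * (Real.log 2 + Real.log (Real.sin φ)) := by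
  have hle : φ - Real.pi ≤ φ := by linarith [Real.pi_pos]
  have hsub : Icc (φ - Real.pi) φ ⊆ Ioo (-Real.pi) Real.pi :=
    fun x hx => ⟨by linarith [hx.1, hφ.1], by linarith [hx.2, hφ.2]⟩
  have hcont : ContinuousOn (fun x => x * Real.log (Real.sin x)) (Icc (φ - Real.pi) φ) := by
    refine ContinuousOn.congr ?_ fun x hx => mul_log_sin_eq (hsub hx)
    exact Real.continuous_mul_log.continuousOn.add (continuousOn_id.mul
      (Real.continuous_sinc.continuousOn.log fun x hx => (sinc_pos (hsub hx)).ne'))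
  have h := integral_eq_of_hasDerivAt_off_countable_of_le
    (fun x => x * Real.log (Real.sin x))
    (fun x => Real.log (Real.sin x) + x * (Real.cos x / Real.sin x)) hle
    (countable_singleton 0) hcont ?_
    ((intervalIntegrable_log_sin' _ _).add (intervalIntegrable_mul_cot hφ))
  · rw [intervalIntegral.integral_add (intervalIntegrable_log_sin' _ _)
      (intervalIntegrable_mul_cot hφ), integral_log_sin_period, Real.sin_sub_pi,
      Real.log_neg_eq_log] at h
    linarith
  · intro x hx
    have hx1 := hsub (Ioo_subset_Icc_self hx.1)
    have h0 : x ≠ 0 := hx.2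
    have hs0 : Real.sin x ≠ 0 := by
      rcases lt_or_gt_of_ne h0 with h | h
      · exact (Real.sin_neg_of_neg_of_neg_pi_lt h hx1.1).ne
      · exact (Real.sin_pos_of_pos_of_lt_pi h hx1.2).ne'
    have := (hasDerivAt_id' x).fun_mul ((Real.hasDerivAt_sin x).log hs0)
    simpa using this

theorem integral_cos_even_mul {n : ℕ} (hn : n ≠ 0) :
    ∫ x in (0 : ℝ)..Real.pi, Real.cos (2 * n * x) = 0 := by
  have hn' : (2 * n : ℝ) ≠ 0 := by positivity
  rw [intervalIntegral.integral_comp_mul_left (fun x => Real.cos x) hn', integral_cos]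
  have : (2 : ℝ) * n * Real.pi = (2 * n : ℕ) * Real.pi := by push_cast; ring
  rw [this, Real.sin_nat_mul_pi]
  simp

/-- The quotient `sin (2 n x) / sin x` and its integral against the cosine. -/
theorem exists_sin_even_quotient (n : ℕ) : ∃ q : ℝ → ℝ, Continuous q ∧
    (∀ x, Real.sin (2 * n * x) = Real.sin x * q x) ∧
    ∫ x in (0 : ℝ)..Real.pi, q x * Real.cos x = if n = 0 then 0 else Real.pi := by
  induction n with
  | zero => exact ⟨0, continuous_zero, by simp, by simp⟩
  | succ n ih =>
    obtain ⟨q, hq, hs, hi⟩ := ih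
    -- From `sin ((2n+2)x) - sin (2nx) = 2 cos ((2n+1)x) sin x`. Multiplied by `cos x`, the new term
    -- becomes `cos ((2n+2)x) + cos (2nx)`, which has nonzero integral only for `n = 0`.
    refine ⟨fun x => q x + 2 * Real.cos ((2 * n + 1) * x), by fun_prop, fun x => ?_, ?_⟩
    · have h1 : (2 * ((n + 1 : ℕ) : ℝ) * x) = (2 * n + 1) * x + x := by push_cast; ring
      have h2 : 2 * (n : ℝ) * x = (2 * n + 1) * x - x := by ring
      have h3 := hs x
      rw [h2, Real.sin_sub] at h3
      rw [h1, Real.sin_add]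
      linear_combination h3
    · have h1 : ∀ x : ℝ, (q x + 2 * Real.cos ((2 * n + 1) * x)) * Real.cos x =
          q x * Real.cos x + (Real.cos (2 * (n + 1 : ℕ) * x) + Real.cos (2 * n * x)) := by
        intro x
        have h1 : (2 * ((n + 1 : ℕ) : ℝ) * x) = (2 * n + 1) * x + x := by push_cast; ring
        have h2 : 2 * (n : ℝ) * x = (2 * n + 1) * x - x := by ring
        rw [h1, h2, Real.cos_add, Real.cos_sub]; ring
      simp only [h1]
      rw [intervalIntegral.integral_add (Continuous.intervalIntegrable (by fun_prop) _ _)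
          (Continuous.intervalIntegrable (by fun_prop) _ _), hi,
        intervalIntegral.integral_add (Continuous.intervalIntegrable (by fun_prop) _ _)
          (Continuous.intervalIntegrable (by fun_prop) _ _), integral_cos_even_mul n.succ_ne_zero]
      rcases eq_or_ne n 0 with rfl | hn
      · simp
      · rw [integral_cos_even_mul hn]; simp [hn]

/-- The Fourier coefficients of `log (sin x)`. -/
theorem integral_cos_even_mul_log_sin {n : ℕ} (hn : n ≠ 0) :
    ∫ x in (0 : ℝ)..Real.pi, Real.cos (2 * n * x) * Real.log (Real.sin x) =
      -Real.pi / (2 * n) := by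
  obtain ⟨q, hq, hs, hi⟩ := exists_sin_even_quotient n
  rw [if_neg hn] at hi
  have hn' : (n : ℝ) ≠ 0 := by exact_mod_cast hn
  -- This is the primitive for integration by parts. The zeros of `sin (2nx)` tame the logarithm at
  -- both endpoints, where the primitive vanishes.
  have hcont : Continuous (fun x => Real.sin (2 * n * x) / (2 * n) * Real.log (Real.sin x)) := by
    have h1 := Real.continuous_mul_log.comp Real.continuous_sin
    have : (fun x => Real.sin (2 * n * x) / (2 * n) * Real.log (Real.sin x)) =
        fun x => q x / (2 * n) * (Real.sin x * Real.log (Real.sin x)) := by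
      funext x; rw [hs]; ring
    rw [this]
    exact (hq.div_const _).mul h1
  have i1 : IntervalIntegrable (fun x => Real.cos (2 * n * x) * Real.log (Real.sin x)) volume
      0 Real.pi :=
    (intervalIntegrable_log_sin' _ _).continuousOn_mul (by fun_prop)
  have i2 : IntervalIntegrable (fun x => (2 * (n : ℝ))⁻¹ * (q x * Real.cos x)) volume
      0 Real.pi := Continuous.intervalIntegrable (by fun_prop) _ _
  have h := integral_eq_of_hasDerivAt_off_countable_of_le
    (fun x => Real.sin (2 * n * x) / (2 * n) * Real.log (Real.sin x))
    (fun x => Real.cos (2 * n * x) * Real.log (Real.sin x) + (2 * (n : ℝ))⁻¹ * (q x * Real.cos x))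
    Real.pi_pos.le countable_empty hcont.continuousOn ?_ (i1.add i2)
  · rw [intervalIntegral.integral_add i1 i2, intervalIntegral.integral_const_mul, hi] at h
    simp only [Real.sin_pi, Real.log_zero, mul_zero, Real.sin_zero, sub_zero] at h
    rw [eq_neg_of_add_eq_zero_left h]; field_simp
  · intro x hx
    have hs0 : Real.sin x ≠ 0 := (Real.sin_pos_of_pos_of_lt_pi hx.1.1 hx.1.2).ne'
    have h1 : HasDerivAt (fun x => Real.sin (2 * n * x)) (Real.cos (2 * n * x) * (2 * n)) x := by
      simpa using ((hasDerivAt_id x).const_mul (2 * (n : ℝ))).sin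
    have h2 := (h1.div_const (2 * (n : ℝ))).mul ((Real.hasDerivAt_sin x).log hs0)
    refine h2.congr_deriv ?_
    simp only [hs]
    field_simp

theorem integral_log_two_mul_sin :
    ∫ x in (0 : ℝ)..Real.pi, (Real.log 2 + Real.log (Real.sin x)) = 0 := by
  rw [intervalIntegral.integral_add (by simp) (intervalIntegrable_log_sin' _ _),
    integral_log_sin_zero_pi]
  simp; ring

/-- The Fourier series of the Bernoulli polynomial `B₂`, evaluated at `x / π`. The term `n = 0` is
zero because `1 / 0 = 0`. -/
theorem hasSum_cos_even {x : ℝ} (hx : x ∈ Icc 0 Real.pi) :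
    HasSum (fun n : ℕ => 1 / (n : ℝ) ^ 2 * Real.cos (2 * n * x))
      (Real.pi ^ 2 / 6 - x * (Real.pi - x)) := by
  have hp := Real.pi_pos
  have h := hasSum_one_div_nat_pow_mul_cos one_ne_zero (x := x / Real.pi)
    ⟨by have := hx.1; positivity, (div_le_one hp).2 hx.2⟩
  have hB : (Polynomial.map (algebraMap ℚ ℝ) (Polynomial.bernoulli (2 * 1))).eval (x / Real.pi) =
      (x / Real.pi) ^ 2 - x / Real.pi + 1 / 6 := by
    simp [Polynomial.bernoulli, Finset.sum_range_succ, Polynomial.eval_add, bernoulli_one,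
      bernoulli_two]
    ring
  rw [hB] at h
  convert h using 1
  · funext n
    congr 2
    field_simp
  · simp [Nat.factorial]
    field_simp
    ring

/-- The integral producing `ζ(3)`. -/
theorem integral_mul_log_two_mul_sin :
    ∫ x in (0 : ℝ)..Real.pi, x * (Real.pi - x) * (Real.log 2 + Real.log (Real.sin x)) =
      Real.pi / 2 * ∑' n : ℕ, 1 / (n : ℝ) ^ 3 := by
  have hL : IntervalIntegrable (fun x => Real.log 2 + Real.log (Real.sin x)) volume 0 Real.pi :=
    IntervalIntegrable.add (by simp) (intervalIntegrable_log_sin' _ _)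
  have hsum2 : Summable fun n : ℕ => 1 / (n : ℝ) ^ 2 := Real.summable_one_div_nat_pow.2 one_lt_two
  -- The cosine series of `π² / 6 - x (π - x)` is integrated term by term against `log (2 sin x)`.
  -- The `n`-th term gives `-(π / 2) / n³`, and the constant `π² / 6` contributes nothing because
  -- `log (2 sin x)` has mean zero.
  have key := intervalIntegral.hasSum_integral_of_dominated_convergence
    (μ := volume) (a := 0) (b := Real.pi)
    (F := fun (n : ℕ) x => 1 / (n : ℝ) ^ 2 * Real.cos (2 * n * x) *
      (Real.log 2 + Real.log (Real.sin x)))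
    (f := fun x => (Real.pi ^ 2 / 6 - x * (Real.pi - x)) * (Real.log 2 + Real.log (Real.sin x)))
    (fun (n : ℕ) x => 1 / (n : ℝ) ^ 2 * |Real.log 2 + Real.log (Real.sin x)|)
    (fun n => ?_) (fun n => ?_) ?_ ?_ ?_
  · have hterm : ∀ n : ℕ, ∫ x in (0 : ℝ)..Real.pi, 1 / (n : ℝ) ^ 2 * Real.cos (2 * n * x) *
        (Real.log 2 + Real.log (Real.sin x)) = -(Real.pi / 2) * (1 / (n : ℝ) ^ 3) := by
      intro n
      rcases eq_or_ne n 0 with rfl | hn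
      · simp
      have hn' : (n : ℝ) ≠ 0 := by exact_mod_cast hn
      have : ∀ x, 1 / (n : ℝ) ^ 2 * Real.cos (2 * n * x) *
          (Real.log 2 + Real.log (Real.sin x)) = 1 / (n : ℝ) ^ 2 * (Real.log 2 *
          Real.cos (2 * n * x) + Real.cos (2 * n * x) * Real.log (Real.sin x)) := by
        intro x; ring
      simp only [this]
      rw [intervalIntegral.integral_const_mul, intervalIntegral.integral_add
        (Continuous.intervalIntegrable (by fun_prop) _ _)
        ((intervalIntegrable_log_sin' _ _).continuousOn_mul (by fun_prop)),
        intervalIntegral.integral_const_mul, integral_cos_even_mul hn,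
        integral_cos_even_mul_log_sin hn]
      field_simp
      ring
    simp only [hterm] at key
    have h3 := (((Real.summable_one_div_nat_pow (p := 3)).2 (by norm_num)).hasSum.mul_left
      (-(Real.pi / 2))).unique key
    have hsplit : ∀ x, (Real.pi ^ 2 / 6 - x * (Real.pi - x)) *
        (Real.log 2 + Real.log (Real.sin x)) =
        Real.pi ^ 2 / 6 * (Real.log 2 + Real.log (Real.sin x)) -
          x * (Real.pi - x) * (Real.log 2 + Real.log (Real.sin x)) := fun x => by ring
    simp only [hsplit] at h3
    rw [intervalIntegral.integral_sub (hL.const_mul _)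
      (hL.continuousOn_mul (by fun_prop)), intervalIntegral.integral_const_mul,
      integral_log_two_mul_sin] at h3
    linarith
  · exact (hL.continuousOn_mul (by fun_prop)).def'.aestronglyMeasurable
  · refine ae_of_all _ fun x _ => ?_
    rw [norm_mul, norm_mul, Real.norm_of_nonneg (by positivity : (0 : ℝ) ≤ 1 / (n : ℝ) ^ 2),
      Real.norm_eq_abs, Real.norm_eq_abs]
    gcongr
    exact mul_le_of_le_one_right (by positivity) (Real.abs_cos_le_one _)
  · exact ae_of_all _ fun x _ => hsum2.mul_right _
  · have : (fun x => ∑' n : ℕ, 1 / (n : ℝ) ^ 2 * |Real.log 2 + Real.log (Real.sin x)|) =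
        fun x => (∑' n : ℕ, 1 / (n : ℝ) ^ 2) * |Real.log 2 + Real.log (Real.sin x)| := by
      funext x; rw [tsum_mul_right]
    rw [this]
    exact hL.abs.const_mul _
  · refine ae_of_all _ fun x hx => ?_
    rw [uIoc_of_le Real.pi_pos.le] at hx
    exact (hasSum_cos_even (Ioc_subset_Icc_self hx)).mul_right _

/-! ### Integrating the pair kernel. -/

/-- The kernel of the two vertices `x`, `y` joined by a double edge, as a function of `y`. -/
def pairKernel (x y : ℂ) : ℂ :=
  (y - starRingEnd ℂ y) / ((y * starRingEnd ℂ y) *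
    ((x - starRingEnd ℂ y) * (starRingEnd ℂ x - y) * (x - y)))

@[fun_prop]
theorem measurable_pairKernel (x : ℂ) : Measurable (pairKernel x) := by
  unfold pairKernel; fun_prop

theorem three_pole_partialFraction {a r₁ r₂ r₃ r : ℂ} (h₁₂ : r₁ - r₂ ≠ 0) (h₁₃ : r₁ - r₃ ≠ 0)
    (h₂₃ : r₂ - r₃ ≠ 0) (h₁ : r - r₁ ≠ 0) (h₂ : r - r₂ ≠ 0) (h₃ : r - r₃ ≠ 0) :
    a / ((r - r₁) * (r - r₂) * (r - r₃)) =
      a / ((r₁ - r₂) * (r₁ - r₃)) / (r - r₁) + -(a / ((r₁ - r₂) * (r₂ - r₃))) / (r - r₂) +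
        a / ((r₁ - r₃) * (r₂ - r₃)) / (r - r₃) := by
  field_simp
  ring

theorem three_pole_residues {a r₁ r₂ r₃ : ℂ} (h₁₂ : r₁ - r₂ ≠ 0) (h₁₃ : r₁ - r₃ ≠ 0)
    (h₂₃ : r₂ - r₃ ≠ 0) :
    a / ((r₁ - r₂) * (r₁ - r₃)) + -(a / ((r₁ - r₂) * (r₂ - r₃))) +
        a / ((r₁ - r₃) * (r₂ - r₃)) = 0 := by
  field_simp
  ring

theorem exp_sub_exp_neg_ne_zero {α : ℝ} (h : Real.sin α ≠ 0) :
    exp (α * I) - exp (-(α * I)) ≠ 0 := by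
  have : exp (α * I) - exp (-(α * I)) = 2 * I * (Real.sin α : ℂ) := by
    rw [Complex.ofReal_sin, Complex.sin, neg_mul]
    linear_combination (exp (α * I) - exp (-(α * I))) * I_sq
  rw [this]
  exact mul_ne_zero (by simp) (by exact_mod_cast h)

theorem cot_eq_exp (α : ℝ) :
    ((Real.cos α / Real.sin α : ℝ) : ℂ) =
      I * (exp (α * I) + exp (-(α * I))) / (exp (α * I) - exp (-(α * I))) := by
  have h1 : exp (α * I) - exp (-(α * I)) = 2 * I * (Real.sin α : ℂ) := by
    rw [Complex.ofReal_sin, Complex.sin, neg_mul]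
    linear_combination (exp (α * I) - exp (-(α * I))) * I_sq
  have h2 : exp (α * I) + exp (-(α * I)) = 2 * (Real.cos α : ℂ) := by
    rw [Complex.ofReal_cos, Complex.cos, neg_mul]; ring
  rw [h1, h2]
  push_cast
  rcases eq_or_ne (Complex.sin α) 0 with h | h
  · simp [h]
  · field_simp

/-- The three poles have modulus `ρ` and arguments `φ - θ`, `φ + θ`, `-(φ + θ)`. The residues at the
first two reduce to the cotangents of `φ` and `φ + θ`, and the third is minus their sum. For `θ = φ`
a pole lies on the path of integration; for `θ = π - φ` two poles collide. -/
theorem pairKernel_polar_integral {ρ φ θ : ℝ} (hρ : 0 < ρ) (hφ : φ ∈ Ioo 0 Real.pi)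
    (hθ : θ ∈ Ioo 0 Real.pi) (hne : θ ≠ φ) (hne' : θ ≠ Real.pi - φ)
    (hi : IntegrableOn (fun r : ℝ => (r : ℂ) *
      pairKernel (ρ * exp (φ * I)) (r * exp (θ * I))) (Ioi 0)) :
    ∫ r in Ioi (0 : ℝ), (r : ℂ) * pairKernel (ρ * exp (φ * I)) (r * exp (θ * I)) =
      -(1 / (2 * (ρ : ℂ) ^ 2)) *
        ((angleJump φ θ : ℂ) * ((Real.cos φ / Real.sin φ : ℝ) - I) +
          ((φ + θ - Real.pi : ℝ) : ℂ) * ((Real.cos φ / Real.sin φ : ℝ) -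
            2 * (Real.cos (φ + θ) / Real.sin (φ + θ) : ℝ) + I)) := by
  have hρ0 : (ρ : ℂ) ≠ 0 := by exact_mod_cast hρ.ne'
  have hα : φ + θ - Real.pi ∈ Ioo (-Real.pi) Real.pi :=
    ⟨by linarith [hφ.1, hθ.1], by linarith [hφ.2, hθ.2]⟩
  have hα' : -(φ + θ) + Real.pi ∈ Ioo (-Real.pi) Real.pi :=
    ⟨by linarith [hφ.2, hθ.2], by linarith [hφ.1, hθ.1]⟩
  have hsφ : Real.sin φ ≠ 0 := (Real.sin_pos_of_pos_of_lt_pi hφ.1 hφ.2).ne'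
  have hsθ : Real.sin θ ≠ 0 := (Real.sin_pos_of_pos_of_lt_pi hθ.1 hθ.2).ne'
  have hsα : Real.sin (φ + θ) ≠ 0 := by
    have h0 : φ + θ - Real.pi ≠ 0 := fun h => hne' (by linarith)
    have : Real.sin (φ + θ - Real.pi) ≠ 0 := by
      rcases lt_or_gt_of_ne h0 with h | h
      · exact (Real.sin_neg_of_neg_of_neg_pi_lt h hα.1).ne
      · exact (Real.sin_pos_of_pos_of_lt_pi h hα.2).ne'
    rwa [Real.sin_sub_pi, neg_ne_zero] at this
  have m1 : -(ρ * exp ((φ - θ : ℝ) * I)) ∈ slitPlane := by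
    rw [neg_polar_angleJump]
    exact ofReal_mul_exp_mem_slitPlane hρ (angleJump_mem hφ hθ hne)
  have m2 : -(ρ * exp ((φ + θ : ℝ) * I)) ∈ slitPlane := by
    rw [neg_ofReal_mul_exp_sub]; exact ofReal_mul_exp_mem_slitPlane hρ hα
  have m3 : -(ρ * exp ((-(φ + θ) : ℝ) * I)) ∈ slitPlane := by
    rw [neg_ofReal_mul_exp_add]; exact ofReal_mul_exp_mem_slitPlane hρ hα'
  have l1 : log (-(ρ * exp ((φ - θ : ℝ) * I))) = Real.log ρ + angleJump φ θ * I := by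
    rw [neg_polar_angleJump, log_ofReal_mul_exp hρ (angleJump_mem hφ hθ hne)]
  have l2 : log (-(ρ * exp ((φ + θ : ℝ) * I))) = Real.log ρ + (φ + θ - Real.pi : ℝ) * I := by
    rw [neg_ofReal_mul_exp_sub, log_ofReal_mul_exp hρ hα]
  have l3 : log (-(ρ * exp ((-(φ + θ) : ℝ) * I))) =
      Real.log ρ - (φ + θ - Real.pi : ℝ) * I := by
    rw [neg_ofReal_mul_exp_add, log_ofReal_mul_exp hρ hα']; push_cast; ring
  have hA : exp ((φ + θ : ℝ) * I) = exp (φ * I) * exp (θ * I) := by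
    rw [← Complex.exp_add]; push_cast; ring_nf
  have hA' : exp (-((φ + θ : ℝ) * I)) = exp (-(φ * I)) * exp (-(θ * I)) := by
    rw [← Complex.exp_add]; push_cast; ring_nf
  have hC : exp ((-(φ + θ) : ℝ) * I) = exp (-(φ * I)) * exp (-(θ * I)) := by
    rw [← Complex.exp_add]; push_cast; ring_nf
  have hB : exp ((φ - θ : ℝ) * I) = exp (φ * I) * exp (-(θ * I)) := by
    rw [← Complex.exp_add]; push_cast; ring_nf
  have hw : exp (θ * I) * exp (-(θ * I)) = 1 := by rw [← Complex.exp_add]; simp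
  have he : exp (φ * I) * exp (-(φ * I)) = 1 := by rw [← Complex.exp_add]; simp
  have d1 := exp_sub_exp_neg_ne_zero hsφ
  have d2 := exp_sub_exp_neg_ne_zero hsθ
  have d3 := exp_sub_exp_neg_ne_zero hsα
  rw [cot_eq_exp φ, cot_eq_exp (φ + θ)]
  have w0 := Complex.exp_ne_zero (θ * I)
  have w1 := Complex.exp_ne_zero (-(θ * I))
  have e0 := Complex.exp_ne_zero (φ * I)
  have e1 := Complex.exp_ne_zero (-(φ * I))
  have hker : ∀ r : ℝ, pairKernel (ρ * exp (φ * I)) (r * exp (θ * I)) =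
      (r * exp (θ * I) - r * exp (-(θ * I))) / ((r * exp (θ * I) * (r * exp (-(θ * I)))) *
        ((ρ * exp (φ * I) - r * exp (-(θ * I))) * (ρ * exp (-(φ * I)) - r * exp (θ * I)) *
          (ρ * exp (φ * I) - r * exp (θ * I)))) := by
    intro r
    simp only [pairKernel, map_mul, conj_exp_mul_I, conj_ofReal]
  simp only [hker] at hi ⊢
  rw [hA] at m2 l2 d3
  rw [hA'] at d3
  rw [hA, hA']
  rw [hB] at m1 l1
  rw [hC] at m3 l3
  clear hA hA' hB hC hker
  generalize exp (θ * I) = w at *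
  generalize exp (-(θ * I)) = w' at *
  generalize exp (φ * I) = e at *
  generalize exp (-(φ * I)) = e' at *
  have h12 : ρ * (e * w') - ρ * (e * w) ≠ 0 := by
    have : ρ * (e * w') - ρ * (e * w) = -(ρ * e * (w - w')) := by ring
    rw [this]; simp [*]
  have h13 : ρ * (e * w') - ρ * (e' * w') ≠ 0 := by
    have : ρ * (e * w') - ρ * (e' * w') = ρ * w' * (e - e') := by ring
    rw [this]; simp [*]
  have h23 : ρ * (e * w) - ρ * (e' * w') ≠ 0 := by
    rw [← mul_sub]; exact mul_ne_zero hρ0 d3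
  -- The numerator that remains once all powers of `r` have cancelled, using `w * w' = 1`.
  set A : ℂ := -((w - w') * w') with hAdef
  have heq : EqOn (fun r : ℝ => (r : ℂ) * ((r * w - r * w') / ((r * w * (r * w')) *
        ((ρ * e - r * w') * (ρ * e' - r * w) * (ρ * e - r * w)))))
      (fun r : ℝ => ∑ i : Fin 3, (![
        A / ((ρ * (e * w') - ρ * (e * w)) * (ρ * (e * w') - ρ * (e' * w'))),
        -(A / ((ρ * (e * w') - ρ * (e * w)) * (ρ * (e * w) - ρ * (e' * w')))),
        A / ((ρ * (e * w') - ρ * (e' * w')) * (ρ * (e * w) - ρ * (e' * w')))] : Fin 3 → ℂ) i /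
          ((r : ℂ) - (![ρ * (e * w'), ρ * (e * w), ρ * (e' * w')] : Fin 3 → ℂ) i))
      (Ioi 0) := by
    intro r hr
    have hr0 : (r : ℂ) ≠ 0 := by exact_mod_cast (ne_of_gt hr)
    have n1 := slitPlane_ne_zero (add_mem_slitPlane_of_nonneg m1 (le_of_lt hr))
    have n2 := slitPlane_ne_zero (add_mem_slitPlane_of_nonneg m2 (le_of_lt hr))
    have n3 := slitPlane_ne_zero (add_mem_slitPlane_of_nonneg m3 (le_of_lt hr))
    rw [← sub_eq_add_neg] at n1 n2 n3
    simp only [Fin.sum_univ_three, Matrix.cons_val_zero, Matrix.cons_val_one, Matrix.cons_val]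
    rw [← three_pole_partialFraction h12 h13 h23 n1 n2 n3]
    have k1 : ρ * e - r * w = -(w * (r - ρ * (e * w'))) := by linear_combination -ρ * e * hw
    have k2 : ρ * e - r * w' = -(w' * (r - ρ * (e * w))) := by linear_combination -ρ * e * hw
    have k3 : ρ * e' - r * w = -(w * (r - ρ * (e' * w'))) := by linear_combination -ρ * e' * hw
    rw [k1, k2, k3, hAdef, mul_div_assoc', div_eq_div_iff (by simp [*]) (by simp [*])]
    linear_combination (r : ℂ) ^ 2 * (w - w') * (r - ρ * (e * w')) * (r - ρ * (e * w)) *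
      (r - ρ * (e' * w')) * (-(w * w') ^ 2 - (w * w') - 1) * hw
  rw [setIntegral_congr_fun measurableSet_Ioi heq, integral_Ioi_partialFractions]
  · simp only [Fin.sum_univ_three, Matrix.cons_val_zero, Matrix.cons_val_one, Matrix.cons_val]
    rw [l1, l2, l3]
    have hres := three_pole_residues (a := A) h12 h13 h23
    have c1 : A / ((ρ * (e * w') - ρ * (e * w)) * (ρ * (e * w') - ρ * (e' * w'))) =
        e' / (ρ ^ 2 * (e - e')) := by
      rw [div_eq_div_iff (mul_ne_zero h12 h13) (by simp [*]), hAdef]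
      linear_combination -(ρ ^ 2 * (e - e') * w' * (w' - w)) * he
    have c2 : -(A / ((ρ * (e * w') - ρ * (e * w)) * (ρ * (e * w) - ρ * (e' * w')))) =
        -(e' * w') / (ρ ^ 2 * (e * w - e' * w')) := by
      rw [← neg_div, div_eq_div_iff (mul_ne_zero h12 h23) (by simp [*]), hAdef]
      linear_combination -(ρ ^ 2 * (e * w - e' * w') * w' * (w - w')) * he
    rw [c1, c2] at hres ⊢
    have hlast := eq_neg_of_add_eq_zero_right hres
    rw [hlast]
    field_simp
    ring
  · simp only [Fin.sum_univ_three, Matrix.cons_val_zero, Matrix.cons_val_one, Matrix.cons_val]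
    exact three_pole_residues h12 h13 h23
  · intro i
    fin_cases i
    · exact m1
    · exact m2
    · exact m3
  · exact (integrableOn_congr_fun heq measurableSet_Ioi).1 hi

/-- The cotangent has period `π`, so the shift `x = φ + θ - π` reduces this to `integral_mul_cot`.
-/
theorem integrableOn_shifted_mul_cot {φ : ℝ} (hφ : φ ∈ Ioo 0 Real.pi) :
    IntegrableOn (fun θ => (φ + θ - Real.pi) * (Real.cos (φ + θ) / Real.sin (φ + θ)))
      (Ioo 0 Real.pi) ∧
    ∫ θ in Ioo 0 Real.pi, (φ + θ - Real.pi) * (Real.cos (φ + θ) / Real.sin (φ + θ)) =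
      Real.pi * (Real.log 2 + Real.log (Real.sin φ)) := by
  have h1 : (fun θ => (φ + θ - Real.pi) * (Real.cos (φ + θ) / Real.sin (φ + θ))) =
      fun θ => (fun x => x * (Real.cos x / Real.sin x)) (θ + (φ - Real.pi)) := by
    funext θ
    have h : φ + θ = θ + (φ - Real.pi) + Real.pi := by ring
    simp only [h, Real.cos_add_pi, Real.sin_add_pi, neg_div_neg_eq]
    ring
  have hi := intervalIntegrable_mul_cot hφ
  constructor
  · rw [h1, ← intervalIntegrable_iff_integrableOn_Ioo_of_le Real.pi_pos.le]
    have := hi.comp_add_right (φ - Real.pi)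
    simpa using this
  · rw [h1, ← integral_Ioc_eq_integral_Ioo, ← intervalIntegral.integral_of_le Real.pi_pos.le,
      intervalIntegral.integral_comp_add_right (fun x => x * (Real.cos x / Real.sin x)),
      ← integral_mul_cot hφ]
    congr 1 <;> ring

theorem integrableOn_shift (φ : ℝ) :
    IntegrableOn (fun θ => φ + θ - Real.pi) (Ioo 0 Real.pi) ∧
    ∫ θ in Ioo 0 Real.pi, (φ + θ - Real.pi) = Real.pi * φ - Real.pi ^ 2 / 2 := by
  refine ⟨(Continuous.integrableOn_Icc (by fun_prop)).mono_set Ioo_subset_Icc_self, ?_⟩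
  rw [← integral_Ioc_eq_integral_Ioo, ← intervalIntegral.integral_of_le Real.pi_pos.le,
    intervalIntegral.integral_sub (Continuous.intervalIntegrable (by fun_prop) _ _) (by simp),
    intervalIntegral.integral_add (by simp) (by simp)]
  simp
  ring

/-- The integrals of `angleJump φ θ` and `φ + θ - π` over `θ` are opposite, so the terms with `cot
φ` cancel. The terms with `cot (φ + θ)` give the logarithm. -/
theorem integral_pairKernel {ρ φ : ℝ} (hρ : 0 < ρ) (hφ : φ ∈ Ioo 0 Real.pi)
    (hint : IntegrableOn (pairKernel (ρ * exp (φ * I))) upperHalf) :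
    ∫ y in upperHalf, pairKernel (ρ * exp (φ * I)) y =
      1 / (ρ : ℂ) ^ 2 * ((Real.pi * (Real.log 2 + Real.log (Real.sin φ)) : ℝ) +
        (Real.pi ^ 2 / 2 - Real.pi * φ : ℝ) * I) := by
  rw [integral_polar_upperHalf (by fun_prop) hint]
  have hp := integrable_polar_upperHalf (by fun_prop) hint
  rw [IntegrableOn, Measure.volume_eq_prod, ← Measure.prod_restrict] at hp
  have hp' := hp.prod_left_ae
  obtain ⟨ij, ej⟩ := integral_angleJump hφ
  obtain ⟨is, es⟩ := integrableOn_shift φ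
  obtain ⟨ic, ec⟩ := integrableOn_shifted_mul_cot hφ
  set k := Real.cos φ / Real.sin φ
  have key : ∀ᵐ θ : ℝ ∂(volume.restrict (Ioo 0 Real.pi)),
      ∫ r in Ioi (0 : ℝ), (r : ℂ) * pairKernel (ρ * exp (φ * I)) (r * exp (θ * I)) =
        -(1 / (2 * (ρ : ℂ) ^ 2)) * ((((angleJump φ θ + (φ + θ - Real.pi)) * k -
          2 * ((φ + θ - Real.pi) * (Real.cos (φ + θ) / Real.sin (φ + θ))) : ℝ) : ℂ) -
          ((angleJump φ θ - (φ + θ - Real.pi) : ℝ) : ℂ) * I) := by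
    filter_upwards [hp', ae_restrict_mem measurableSet_Ioo, ae_ne_of_restrict _ φ,
      ae_ne_of_restrict _ (Real.pi - φ)] with θ hi hθ hne hne'
    rw [pairKernel_polar_integral hρ hφ hθ hne hne' hi,
      show ((Real.cos φ / Real.sin φ : ℝ) : ℂ) = (k : ℂ) from rfl]
    push_cast
    ring
  have i1 : IntegrableOn (fun θ => (angleJump φ θ + (φ + θ - Real.pi)) * k -
      2 * ((φ + θ - Real.pi) * (Real.cos (φ + θ) / Real.sin (φ + θ)))) (Ioo 0 Real.pi) :=
    (Integrable.mul_const (ij.add is) k).sub (ic.const_mul 2)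
  have i2 : IntegrableOn (fun θ => angleJump φ θ - (φ + θ - Real.pi)) (Ioo 0 Real.pi) :=
    ij.sub is
  have j1 : IntegrableOn (fun θ => (((angleJump φ θ + (φ + θ - Real.pi)) * k -
      2 * ((φ + θ - Real.pi) * (Real.cos (φ + θ) / Real.sin (φ + θ))) : ℝ) : ℂ))
      (Ioo 0 Real.pi) := i1.ofReal
  have j2 : IntegrableOn (fun θ => ((angleJump φ θ - (φ + θ - Real.pi) : ℝ) : ℂ))
      (Ioo 0 Real.pi) := i2.ofReal
  have ia : IntegrableOn (fun θ => angleJump φ θ + (φ + θ - Real.pi)) (Ioo 0 Real.pi) :=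
    ij.add is
  rw [integral_congr_ae key, integral_const_mul, integral_sub j1 (j2.mul_const I),
    integral_mul_const, integral_complex_ofReal, integral_complex_ofReal, integral_sub ij is,
    integral_sub (ia.mul_const k) (ic.const_mul 2), integral_mul_const,
    integral_const_mul, integral_add ij is, ej, es, ec]
  push_cast
  have hρ0 : (ρ : ℂ) ≠ 0 := by exact_mod_cast hρ.ne'
  field_simp
  ring

/-! ### The radial integral over `x`. -/

/-- Radial integral of the angle at `1`, weighted by the inverse square distance to `1`. -/
theorem integral_arg_div_normSq {φ : ℝ} (hφ : φ ∈ Ioo 0 Real.pi) :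
    ∫ ρ in Ioi (0 : ℝ), (arg (ρ * exp (φ * I) - 1) / Real.pi - 1 / 2) /
        normSq (ρ * exp (φ * I) - 1) = φ * (Real.pi - φ) / (2 * Real.pi * Real.sin φ) := by
  have hs : 0 < Real.sin φ := Real.sin_pos_of_pos_of_lt_pi hφ.1 hφ.2
  set ψ : ℝ → ℝ := fun ρ => arg (ρ * exp (φ * I) - 1)
  have him : ∀ ρ : ℝ, (ρ * exp (φ * I) - 1 : ℂ).im = ρ * Real.sin φ := by
    intro ρ
    rw [Complex.sub_im, Complex.im_ofReal_mul, Complex.exp_ofReal_mul_I_im]; simp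
  have hre : ∀ ρ : ℝ, (ρ * exp (φ * I) - 1 : ℂ).re = ρ * Real.cos φ - 1 := by
    intro ρ
    rw [Complex.sub_re, Complex.re_ofReal_mul, Complex.exp_ofReal_mul_I_re]; simp
  -- Up to the constant `-sin φ` the weight is the derivative of the angle `ψ`, so the integrand is
  -- exact: a combination of the derivatives of `ψ ^ 2` and `ψ`. The boundary values are `ψ 0 = π`
  -- and `ψ → φ`.
  have hd : ∀ ρ ∈ Ioi (0 : ℝ), HasDerivAt ψ
      (-(Real.sin φ / normSq (ρ * exp (φ * I) - 1))) ρ := by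
    intro ρ hρ
    have hsl : (ρ * exp (φ * I) - 1 : ℂ) ∈ slitPlane := by
      rw [mem_slitPlane_iff, him]; right; exact (mul_pos hρ hs).ne'
    have h1 : HasDerivAt (fun ρ : ℝ => (ρ * exp (φ * I) - 1 : ℂ)) (exp (φ * I)) ρ := by
      simpa using ((Complex.ofRealCLM.hasDerivAt (x := ρ)).mul_const (exp (φ * I))).sub_const 1
    have h2 := (Complex.imCLM.hasFDerivAt.comp_hasDerivAt ρ (h1.clog_real hsl))
    have h3 : ⇑imCLM ∘ (fun ρ : ℝ => log (ρ * exp (φ * I) - 1)) = ψ := by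
      funext x; simp [ψ, Complex.log_im]
    rw [h3] at h2
    refine h2.congr_deriv ?_
    rw [imCLM_apply, Complex.div_im, him, hre, Complex.exp_ofReal_mul_I_im,
      Complex.exp_ofReal_mul_I_re]
    ring
  have h0 : ψ 0 = Real.pi := by simp [ψ, Complex.arg_neg_one]
  -- At `ρ = 0` the point `-1` lies on the branch cut, but it is approached from the closed upper
  -- side, where `arg` is continuous.
  have hc : ContinuousWithinAt ψ (Ici 0) 0 := by
    have h1 := Complex.continuousWithinAt_arg_of_re_neg_of_im_zero (z := (-1 : ℂ))
      (by simp) (by simp)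
    have h2 : ContinuousWithinAt (fun ρ : ℝ => (ρ * exp (φ * I) - 1 : ℂ)) (Ici 0) 0 :=
      Continuous.continuousWithinAt (by fun_prop)
    have h3 : ((0 : ℝ) * exp (φ * I) - 1 : ℂ) = -1 := by simp
    rw [← h3] at h1
    refine ContinuousWithinAt.comp (f := fun ρ : ℝ => (ρ * exp (φ * I) - 1 : ℂ)) h1 h2 ?_
    intro ρ hρ
    simp only [mem_ofPred_eq, him]
    exact mul_nonneg hρ hs.le
  have hlim : Tendsto ψ atTop (𝓝 φ) := by
    have h1 : Tendsto (fun ρ : ℝ => arg (exp (φ * I) - ((ρ⁻¹ : ℝ) : ℂ))) atTop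
        (𝓝 (arg (exp (φ * I) - ((0 : ℝ) : ℂ)))) := by
      have hsl : exp (φ * I) - ((0 : ℝ) : ℂ) ∈ slitPlane := by
        rw [mem_slitPlane_iff]; right
        rw [Complex.sub_im, Complex.exp_ofReal_mul_I_im]; simpa using hs.ne'
      exact (Complex.continuousAt_arg hsl).tendsto.comp
        (((Complex.continuous_ofReal.tendsto _).comp tendsto_inv_atTop_zero).const_sub _)
    have h2 : arg (exp (φ * I) - ((0 : ℝ) : ℂ)) = φ := by
      rw [Complex.ofReal_zero, sub_zero, Complex.exp_mul_I]
      exact Complex.arg_cos_add_sin_mul_I ⟨by linarith [hφ.1, Real.pi_pos], hφ.2.le⟩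
    rw [h2] at h1
    refine h1.congr' ?_
    filter_upwards [eventually_gt_atTop 0] with ρ hρ
    have : (ρ * exp (φ * I) - 1 : ℂ) = ρ * (exp (φ * I) - ((ρ⁻¹ : ℝ) : ℂ)) := by
      have : (ρ : ℂ) ≠ 0 := by exact_mod_cast hρ.ne'
      push_cast; field_simp
    simp only [ψ]
    rw [this, Complex.arg_real_mul _ hρ]
  have hneg : ∀ ρ ∈ Ioi (0 : ℝ), -(Real.sin φ / normSq (ρ * exp (φ * I) - 1)) ≤ 0 :=
    fun ρ _ => neg_nonpos.2 (div_nonneg hs.le (normSq_nonneg _))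
  have hψ : ∀ ρ ∈ Ioi (0 : ℝ), 0 ≤ ψ ρ := fun ρ hρ =>
    Complex.arg_nonneg_iff.2 (by rw [him]; exact (mul_pos hρ hs).le)
  have hd2 : ∀ ρ ∈ Ioi (0 : ℝ), HasDerivAt (fun ρ => ψ ρ ^ 2)
      (2 * ψ ρ * -(Real.sin φ / normSq (ρ * exp (φ * I) - 1))) ρ := by
    intro ρ hρ
    simpa using (hd ρ hρ).fun_pow 2
  have hneg2 : ∀ ρ ∈ Ioi (0 : ℝ),
      2 * ψ ρ * -(Real.sin φ / normSq (ρ * exp (φ * I) - 1)) ≤ 0 := fun ρ hρ =>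
    mul_nonpos_of_nonneg_of_nonpos (mul_nonneg zero_le_two (hψ ρ hρ)) (hneg ρ hρ)
  have I1 := integral_Ioi_of_hasDerivAt_of_nonpos hc hd hneg hlim
  have J1 := integrableOn_Ioi_deriv_of_nonpos hc hd hneg hlim
  have I2 := integral_Ioi_of_hasDerivAt_of_nonpos (hc.pow 2) hd2 hneg2 (hlim.pow 2)
  have J2 := integrableOn_Ioi_deriv_of_nonpos (hc.pow 2) hd2 hneg2 (hlim.pow 2)
  have heq : ∀ ρ : ℝ, (arg (ρ * exp (φ * I) - 1) / Real.pi - 1 / 2) /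
        normSq (ρ * exp (φ * I) - 1) =
      -(1 / (2 * Real.pi * Real.sin φ)) *
        (2 * ψ ρ * -(Real.sin φ / normSq (ρ * exp (φ * I) - 1))) +
      1 / (2 * Real.sin φ) * -(Real.sin φ / normSq (ρ * exp (φ * I) - 1)) := by
    intro ρ
    have := Real.pi_pos.ne'
    have := hs.ne'
    simp only [ψ]
    generalize normSq (ρ * exp (φ * I) - 1) = N
    rcases eq_or_ne N 0 with h | h
    · simp [h]
    · field_simp
      ring
  simp only [heq]
  rw [integral_add (J2.const_mul _) (J1.const_mul _), integral_const_mul, integral_const_mul,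
    I1, I2, Pi.pow_apply, h0]
  have := Real.pi_pos.ne'
  have := hs.ne'
  field_simp
  ring

/-! ### Estimates for absolute convergence. -/

/-- A radial profile with different powers near the origin and near infinity. -/
def radialProfile (a b m r : ℝ) : ℝ := r ^ (-a) * max r m ^ (-b)

theorem integral_radialProfile {a b m : ℝ} (ha : a < 2) (hab : 2 < a + b) (hm : 0 < m) :
    IntegrableOn (fun r => r * radialProfile a b m r) (Ioi 0) ∧
    ∫ r in Ioi (0 : ℝ), r * radialProfile a b m r =
      (1 / (2 - a) + 1 / (a + b - 2)) * m ^ (2 - a - b) := by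
  have hu : Ioi (0 : ℝ) = Ioc 0 m ∪ Ioi m := (Ioc_union_Ioi_eq_Ioi hm.le).symm
  have hd : Disjoint (Ioc 0 m) (Ioi m) := Ioc_disjoint_Ioi le_rfl
  have e1 : EqOn (fun r => r * radialProfile a b m r) (fun r => r ^ (1 - a) * m ^ (-b))
      (Ioc 0 m) := fun r hr => by
    simp only [radialProfile, max_eq_right hr.2]
    rw [sub_eq_add_neg, Real.rpow_add hr.1, Real.rpow_one, mul_assoc]
  have e2 : EqOn (fun r => r * radialProfile a b m r) (fun r => r ^ (1 - a - b)) (Ioi m) :=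
    fun r hr => by
    have h0 : 0 < r := hm.trans hr
    simp only [radialProfile, max_eq_left (le_of_lt (mem_Ioi.1 hr))]
    rw [sub_eq_add_neg, sub_eq_add_neg, Real.rpow_add h0, Real.rpow_add h0, Real.rpow_one,
      mul_assoc]
  have j1 : IntegrableOn (fun r : ℝ => r ^ (1 - a) * m ^ (-b)) (Ioc 0 m) := by
    rw [← intervalIntegrable_iff_integrableOn_Ioc_of_le hm.le]
    exact (intervalIntegral.intervalIntegrable_rpow' (by linarith)).mul_const _
  have j2 : IntegrableOn (fun r : ℝ => r ^ (1 - a - b)) (Ioi m) :=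
    integrableOn_Ioi_rpow_of_lt (by linarith) hm
  have i1 := (integrableOn_congr_fun e1 measurableSet_Ioc).2 j1
  have i2 := (integrableOn_congr_fun e2 measurableSet_Ioi).2 j2
  refine ⟨by rw [hu]; exact i1.union i2, ?_⟩
  rw [hu, setIntegral_union hd measurableSet_Ioi i1 i2,
    setIntegral_congr_fun measurableSet_Ioc e1, setIntegral_congr_fun measurableSet_Ioi e2,
    integral_mul_const, ← intervalIntegral.integral_of_le hm.le,
    integral_rpow (Or.inl (by linarith)), integral_Ioi_rpow_of_lt (by linarith) hm]
  have h1 : (1 : ℝ) - a + 1 = 2 - a := by ring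
  have h2 : (1 : ℝ) - a - b + 1 = 2 - a - b := by ring
  have h3 : m ^ (2 - a - b) = m ^ (2 - a) * m ^ (-b) := by
    rw [← Real.rpow_add hm]; ring_nf
  rw [h1, h2, h3, Real.zero_rpow (by linarith)]
  have h4 : 2 - a ≠ 0 := by linarith
  have h5 : 2 - a - b ≠ 0 := by linarith
  have h6 : a + b - 2 ≠ 0 := by linarith
  field_simp
  ring

theorem integral_radialProfile_norm {a b m : ℝ} (ha : a < 2) (hab : 2 < a + b) (hm : 0 < m) :
    Integrable (fun v : ℂ => radialProfile a b m ‖v‖) ∧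
    ∫ v : ℂ, radialProfile a b m ‖v‖ =
      2 * Real.pi * ((1 / (2 - a) + 1 / (a + b - 2)) * m ^ (2 - a - b)) := by
  obtain ⟨h1, h2⟩ := integral_radialProfile ha hab hm
  constructor
  · rw [integrable_fun_norm_addHaar volume (f := radialProfile a b m)]
    simpa [Complex.finrank_real_complex] using h1
  · rw [integral_fun_norm_addHaar volume (radialProfile a b m)]
    simp only [Complex.finrank_real_complex, Nat.add_one_sub_one, pow_one, smul_eq_mul, h2,
      nsmul_eq_mul]
    simp [Measure.real, Complex.volume_ball]
    ring

/-- The larger of the distances from `v` to `0` and to `u` is at least `‖u‖ / 2`, by the triangle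
inequality. The product is thus bounded by a radial profile around the nearer of the two points. -/
theorem mul_rpow_le_radialProfile {a b : ℝ} (ha : 0 < a) (hb : 0 < b) {u : ℂ} (hu : u ≠ 0)
    (v : ℂ) : ‖v‖ ^ (-a) * ‖v - u‖ ^ (-b) ≤
      radialProfile a b (‖u‖ / 2) ‖v‖ + radialProfile b a (‖u‖ / 2) ‖v - u‖ := by
  have hm : 0 < ‖u‖ / 2 := by positivity
  have htri : ‖u‖ ≤ ‖v‖ + ‖v - u‖ := by
    calc ‖u‖ = ‖v - (v - u)‖ := by rw [sub_sub_cancel]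
      _ ≤ _ := norm_sub_le _ _
  have hp : ∀ a b r, 0 ≤ r → 0 ≤ radialProfile a b (‖u‖ / 2) r := fun a b r hr =>
    mul_nonneg (Real.rpow_nonneg hr _) (Real.rpow_nonneg (le_max_of_le_left hr) _)
  rcases le_total ‖v‖ ‖v - u‖ with h | h
  · refine le_add_of_le_of_nonneg ?_ (hp _ _ _ (norm_nonneg _))
    refine mul_le_mul_of_nonneg_left ?_ (Real.rpow_nonneg (norm_nonneg _) _)
    exact Real.rpow_le_rpow_of_nonpos (lt_max_of_lt_right hm) (max_le h (by linarith))
      (by linarith)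
  · refine le_add_of_nonneg_of_le (hp _ _ _ (norm_nonneg _)) ?_
    rw [mul_comm]
    refine mul_le_mul_of_nonneg_left ?_ (Real.rpow_nonneg (norm_nonneg _) _)
    exact Real.rpow_le_rpow_of_nonpos (lt_max_of_lt_right hm) (max_le h (by linarith))
      (by linarith)

/-- Scaling estimate for the convolution of two powers in the plane. -/
theorem exists_integral_mul_rpow_le {a b : ℝ} (ha : a ∈ Ioo (0 : ℝ) 2) (hb : b ∈ Ioo (0 : ℝ) 2)
    (hab : 2 < a + b) : ∃ C : ℝ, 0 ≤ C ∧ ∀ u : ℂ, u ≠ 0 →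
      Integrable (fun v : ℂ => ‖v‖ ^ (-a) * ‖v - u‖ ^ (-b)) ∧
      ∫ v : ℂ, ‖v‖ ^ (-a) * ‖v - u‖ ^ (-b) ≤ C * ‖u‖ ^ (2 - a - b) := by
  refine ⟨(2 * Real.pi * (1 / (2 - a) + 1 / (a + b - 2)) +
    2 * Real.pi * (1 / (2 - b) + 1 / (b + a - 2))) * (1 / 2) ^ (2 - a - b), ?_, fun u hu => ?_⟩
  · have h1 : 0 < 2 - a := by linarith [ha.2]
    have h2 : 0 < 2 - b := by linarith [hb.2]
    have h3 : 0 < a + b - 2 := by linarith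
    have h4 : 0 < b + a - 2 := by linarith
    have := Real.pi_pos
    positivity
  have hm : 0 < ‖u‖ / 2 := by positivity
  obtain ⟨i1, e1⟩ := integral_radialProfile_norm ha.2 hab hm
  obtain ⟨i2, e2⟩ := integral_radialProfile_norm hb.2 (by linarith : 2 < b + a) hm
  have i2' := i2.comp_sub_right u
  have hle := mul_rpow_le_radialProfile ha.1 hb.1 hu
  have hint : Integrable (fun v : ℂ => ‖v‖ ^ (-a) * ‖v - u‖ ^ (-b)) := by
    refine (i1.add i2').mono' (Measurable.aestronglyMeasurable (by fun_prop))
      (ae_of_all _ fun v => ?_)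
    rw [Real.norm_of_nonneg (by positivity)]
    exact hle v
  refine ⟨hint, (integral_mono hint (i1.add i2') hle).trans (le_of_eq ?_)⟩
  have e3 : ∫ v : ℂ, radialProfile b a (‖u‖ / 2) ‖v - u‖ =
      ∫ v : ℂ, radialProfile b a (‖u‖ / 2) ‖v‖ :=
    integral_sub_right_eq_self (fun v : ℂ => radialProfile b a (‖u‖ / 2) ‖v‖) u
  have e4 : (‖u‖ / 2) ^ (2 - a - b) = (1 / 2) ^ (2 - a - b) * ‖u‖ ^ (2 - a - b) := by
    rw [← Real.mul_rpow (by norm_num) (norm_nonneg _)]; ring_nf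
  have e5 : 2 - b - a = 2 - a - b := by ring
  simp only [Pi.add_apply]
  rw [integral_add i1 i2', e3, e1, e2, e5, e4]
  ring

/-- All exponents below are multiples of `1 / 3`; replacing each quantity by a cube turns the power
bounds into polynomial inequalities. -/
theorem cube_rpow_neg {p : ℝ} (hp : 0 ≤ p) (k : ℕ) :
    (p ^ 3) ^ (-((k : ℝ) / 3)) = (p ^ k)⁻¹ := by
  rw [← Real.rpow_natCast p 3, ← Real.rpow_mul hp, ← Real.rpow_natCast p k, ← Real.rpow_neg hp]
  congr 1
  push_cast
  ring

theorem exists_cube_root {p : ℝ} (hp : 0 ≤ p) : ∃ q, 0 ≤ q ∧ p = q ^ 3 :=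
  ⟨p ^ (1 / 3 : ℝ), by positivity, by
    rw [← Real.rpow_natCast, ← Real.rpow_mul hp]; norm_num⟩

/-- Interpolation: `s ≤ p^(2/3) q^(1/3)` and `d^(2/3) ≤ q^(2/3)`. The resulting exponents `4/3` and
`5/3` are below `2` with sum above `2`, as integrability in the plane demands. -/
theorem fork_power_bound {s p q d : ℝ} (hs : 0 < s) (hd : 0 ≤ d) (hsp : s ≤ p) (hsq : s ≤ q)
    (hdq : d ≤ q) :
    s / (d * q * p ^ 2) ≤ p ^ (-(4 / 3 : ℝ)) * d ^ (-(5 / 3 : ℝ)) := by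
  obtain ⟨S, hS, rfl⟩ := exists_cube_root hs.le
  obtain ⟨P, hP, rfl⟩ := exists_cube_root (hs.le.trans hsp)
  obtain ⟨Q, hQ, rfl⟩ := exists_cube_root (hs.le.trans hsq)
  obtain ⟨D, hD, rfl⟩ := exists_cube_root hd
  have h4 := cube_rpow_neg hP 4
  have h5 := cube_rpow_neg hD 5
  push_cast at h4 h5
  rw [h4, h5]
  rw [pow_le_pow_iff_left₀ hS hP (by norm_num)] at hsp
  rw [pow_le_pow_iff_left₀ hS hQ (by norm_num)] at hsq
  rw [pow_le_pow_iff_left₀ hD hQ (by norm_num)] at hdq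
  have hS0 : 0 < S := by
    rcases hS.eq_or_lt with h | h
    · subst h; simp at hs
    · exact h
  have hP0 := hS0.trans_le hsp
  have hQ0 := hS0.trans_le hsq
  rcases hD.eq_or_lt with h | h
  · subst h; simp
  rw [← mul_inv, ← one_div, div_le_div_iff₀ (by positivity) (by positivity)]
  have key : S ^ 2 * S * D ^ 2 ≤ P ^ 2 * Q * Q ^ 2 := by gcongr
  calc S ^ 3 * (P ^ 4 * D ^ 5) = (S ^ 2 * S * D ^ 2) * (P ^ 4 * D ^ 3) := by ring
    _ ≤ (P ^ 2 * Q * Q ^ 2) * (P ^ 4 * D ^ 3) := by gcongr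
    _ = _ := by ring

/-- Here `s ≤ p^(1/3) q^(2/3)`, and `q` also dominates `x^(2/3)` and `d^(2/3)`, which uses up the
two factors `q`. -/
theorem pair_power_bound {s p q d x : ℝ} (hs : 0 < s) (hx : 0 < x) (hd : 0 ≤ d) (hsp : s ≤ p)
    (hsq : s ≤ q) (hxq : x ≤ q) (hdq : d ≤ q) :
    s / (p ^ 2 * (q * q * d)) ≤
      x ^ (-(2 / 3 : ℝ)) * (p ^ (-(5 / 3 : ℝ)) * d ^ (-(5 / 3 : ℝ))) := by
  obtain ⟨S, hS, rfl⟩ := exists_cube_root hs.le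
  obtain ⟨X, hX, rfl⟩ := exists_cube_root hx.le
  obtain ⟨P, hP, rfl⟩ := exists_cube_root (hs.le.trans hsp)
  obtain ⟨Q, hQ, rfl⟩ := exists_cube_root (hs.le.trans hsq)
  obtain ⟨D, hD, rfl⟩ := exists_cube_root hd
  have h2 := cube_rpow_neg hX 2
  have h4 := cube_rpow_neg hP 5
  have h5 := cube_rpow_neg hD 5
  push_cast at h2 h4 h5
  rw [h2, h4, h5]
  rw [pow_le_pow_iff_left₀ hS hP (by norm_num)] at hsp
  rw [pow_le_pow_iff_left₀ hS hQ (by norm_num)] at hsq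
  rw [pow_le_pow_iff_left₀ hX hQ (by norm_num)] at hxq
  rw [pow_le_pow_iff_left₀ hD hQ (by norm_num)] at hdq
  have hS0 : 0 < S := by
    rcases hS.eq_or_lt with h | h
    · subst h; simp at hs
    · exact h
  have hX0 : 0 < X := by
    rcases hX.eq_or_lt with h | h
    · subst h; simp at hx
    · exact h
  have hP0 := hS0.trans_le hsp
  have hQ0 := hS0.trans_le hsq
  rcases hD.eq_or_lt with h | h
  · subst h; simp
  rw [← mul_inv, ← mul_inv, ← one_div, div_le_div_iff₀ (by positivity) (by positivity)]
  have key : S * S ^ 2 * X ^ 2 * D ^ 2 ≤ P * Q ^ 2 * Q ^ 2 * Q ^ 2 := by gcongr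
  calc S ^ 3 * (X ^ 2 * (P ^ 5 * D ^ 5)) =
        (S * S ^ 2 * X ^ 2 * D ^ 2) * (P ^ 5 * D ^ 3) := by ring
    _ ≤ (P * Q ^ 2 * Q ^ 2 * Q ^ 2) * (P ^ 5 * D ^ 3) := by gcongr
    _ = _ := by ring

theorem norm_sub_conj_self (v : ℂ) (hv : v ∈ upperHalf) : ‖v - starRingEnd ℂ v‖ = 2 * v.im := by
  have hv' : 0 < v.im := hv
  rw [Complex.sub_conj, norm_mul, Complex.norm_I, mul_one, Complex.norm_real,
    Real.norm_of_nonneg (by positivity)]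

theorem im_le_norm_conj_sub {u v : ℂ} (hu : u ∈ upperHalf) :
    v.im ≤ ‖starRingEnd ℂ v - u‖ := by
  have hu' : 0 < u.im := hu
  refine le_trans ?_ ((neg_le_abs _).trans (Complex.abs_im_le_norm _))
  simp only [Complex.sub_im, Complex.conj_im]
  linarith

theorem norm_sub_le_norm_conj_sub {u v : ℂ} (hu : u ∈ upperHalf) (hv : v ∈ upperHalf) :
    ‖v - u‖ ≤ ‖starRingEnd ℂ v - u‖ := by
  have hu' : 0 < u.im := hu
  have hv' : 0 < v.im := hv
  rw [Complex.norm_def, Complex.norm_def]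
  refine Real.sqrt_le_sqrt ?_
  simp only [Complex.normSq_apply, Complex.sub_re, Complex.sub_im, Complex.conj_re,
    Complex.conj_im]
  nlinarith [mul_pos hu' hv']

theorem norm_forkKernel_le {u v : ℂ} (hu : u ∈ upperHalf) (hv : v ∈ upperHalf) :
    ‖forkKernel u v‖ ≤ 2 * ‖u‖ * (‖v‖ ^ (-(4 / 3 : ℝ)) * ‖v - u‖ ^ (-(5 / 3 : ℝ))) := by
  have hb := fork_power_bound (s := v.im) (p := ‖v‖) (q := ‖starRingEnd ℂ v - u‖) (d := ‖v - u‖)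
    hv (norm_nonneg _) ((le_abs_self _).trans (Complex.abs_im_le_norm _))
    (im_le_norm_conj_sub hu) (norm_sub_le_norm_conj_sub hu hv)
  refine le_trans (le_of_eq ?_) (mul_le_mul_of_nonneg_left hb (by positivity))
  simp only [forkKernel, norm_div, norm_mul, norm_sub_conj_self v hv, RCLike.norm_conj]
  ring

theorem norm_pairKernel_le {x y : ℂ} (hx : x ∈ upperHalf) (hy : y ∈ upperHalf) :
    ‖pairKernel x y‖ ≤ 2 * x.im ^ (-(2 / 3 : ℝ)) *
      (‖y‖ ^ (-(5 / 3 : ℝ)) * ‖y - x‖ ^ (-(5 / 3 : ℝ))) := by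
  have hq : x.im ≤ ‖starRingEnd ℂ y - x‖ := by
    have := im_le_norm_conj_sub (v := x) hy
    rwa [← RCLike.norm_conj, map_sub, Complex.conj_conj, norm_sub_rev] at this
  have hb := pair_power_bound (s := y.im) (p := ‖y‖) (q := ‖starRingEnd ℂ y - x‖) (d := ‖y - x‖)
    hy hx (norm_nonneg _) ((le_abs_self _).trans (Complex.abs_im_le_norm _))
    (im_le_norm_conj_sub hx) hq (norm_sub_le_norm_conj_sub hx hy)
  have h1 : ‖starRingEnd ℂ x - y‖ = ‖starRingEnd ℂ y - x‖ := by
    rw [← RCLike.norm_conj, map_sub, Complex.conj_conj, norm_sub_rev]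
  have h2 : ‖pairKernel x y‖ = 2 * (y.im / (‖y‖ ^ 2 *
      (‖starRingEnd ℂ y - x‖ * ‖starRingEnd ℂ y - x‖ * ‖y - x‖))) := by
    simp only [pairKernel, norm_div, norm_mul, norm_sub_conj_self y hy, RCLike.norm_conj, h1]
    rw [norm_sub_rev x, norm_sub_rev x y]
    ring
  rw [h2, mul_assoc (2 : ℝ)]
  exact mul_le_mul_of_nonneg_left hb zero_le_two

theorem ne_zero_of_mem_upperHalf {u : ℂ} (hu : u ∈ upperHalf) : u ≠ 0 := by
  rintro rfl
  exact lt_irrefl _ (show (0 : ℝ) < (0 : ℂ).im from hu)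

/-- The bound is uniform in `u` because the prefactor `‖u‖` cancels the scaling exponent `2 - 4/3 -
5/3 = -1`. -/
theorem exists_integral_norm_forkKernel_le : ∃ C : ℝ, 0 ≤ C ∧ ∀ u ∈ upperHalf,
    IntegrableOn (forkKernel u) upperHalf ∧ ∫ v in upperHalf, ‖forkKernel u v‖ ≤ C := by
  obtain ⟨C, hC, h⟩ := exists_integral_mul_rpow_le (a := 4 / 3) (b := 5 / 3)
    (by norm_num) (by norm_num) (by norm_num)
  refine ⟨2 * C, by positivity, fun u hu => ?_⟩
  have hu0 := ne_zero_of_mem_upperHalf hu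
  obtain ⟨hi, hle⟩ := h u hu0
  have hi' := hi.const_mul (2 * ‖u‖)
  have hint : IntegrableOn (forkKernel u) upperHalf :=
    hi'.integrableOn.mono' (measurable_forkKernel u).aestronglyMeasurable
      ((ae_restrict_mem measurableSet_upperHalf).mono fun v hv => norm_forkKernel_le hu hv)
  refine ⟨hint, ?_⟩
  calc ∫ v in upperHalf, ‖forkKernel u v‖
      ≤ ∫ v in upperHalf, 2 * ‖u‖ * (‖v‖ ^ (-(4 / 3 : ℝ)) * ‖v - u‖ ^ (-(5 / 3 : ℝ))) :=
        setIntegral_mono_on hint.norm hi'.integrableOn measurableSet_upperHalf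
          fun v hv => norm_forkKernel_le hu hv
    _ ≤ ∫ v, 2 * ‖u‖ * (‖v‖ ^ (-(4 / 3 : ℝ)) * ‖v - u‖ ^ (-(5 / 3 : ℝ))) :=
        setIntegral_le_integral hi' (ae_of_all _ fun v => by positivity)
    _ ≤ 2 * ‖u‖ * (C * ‖u‖ ^ (2 - 4 / 3 - 5 / 3 : ℝ)) := by
        rw [integral_const_mul]; gcongr
    _ = 2 * C := by
        have h1 : (2 - 4 / 3 - 5 / 3 : ℝ) = -1 := by norm_num
        have : ‖u‖ ≠ 0 := norm_ne_zero_iff.2 hu0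
        rw [h1, Real.rpow_neg_one]
        field_simp

theorem exists_integral_norm_pairKernel_le : ∃ C : ℝ, 0 ≤ C ∧ ∀ x ∈ upperHalf,
    IntegrableOn (pairKernel x) upperHalf ∧
      ∫ y in upperHalf, ‖pairKernel x y‖ ≤
        C * (x.im ^ (-(2 / 3 : ℝ)) * ‖x‖ ^ (-(4 / 3 : ℝ))) := by
  obtain ⟨C, hC, h⟩ := exists_integral_mul_rpow_le (a := 5 / 3) (b := 5 / 3)
    (by norm_num) (by norm_num) (by norm_num)
  refine ⟨2 * C, by positivity, fun x hx => ?_⟩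
  have hx' : 0 < x.im := hx
  obtain ⟨hi, hle⟩ := h x (ne_zero_of_mem_upperHalf hx)
  have hi' := hi.const_mul (2 * x.im ^ (-(2 / 3 : ℝ)))
  have hint : IntegrableOn (pairKernel x) upperHalf :=
    hi'.integrableOn.mono' (measurable_pairKernel x).aestronglyMeasurable
      ((ae_restrict_mem measurableSet_upperHalf).mono fun y hy => norm_pairKernel_le hx hy)
  refine ⟨hint, ?_⟩
  calc ∫ y in upperHalf, ‖pairKernel x y‖
      ≤ ∫ y in upperHalf, 2 * x.im ^ (-(2 / 3 : ℝ)) *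
          (‖y‖ ^ (-(5 / 3 : ℝ)) * ‖y - x‖ ^ (-(5 / 3 : ℝ))) :=
        setIntegral_mono_on hint.norm hi'.integrableOn measurableSet_upperHalf
          fun v hv => norm_pairKernel_le hx hv
    _ ≤ ∫ y, 2 * x.im ^ (-(2 / 3 : ℝ)) *
          (‖y‖ ^ (-(5 / 3 : ℝ)) * ‖y - x‖ ^ (-(5 / 3 : ℝ))) :=
        setIntegral_le_integral hi' (ae_of_all _ fun v => by positivity)
    _ ≤ 2 * x.im ^ (-(2 / 3 : ℝ)) * (C * ‖x‖ ^ (2 - 5 / 3 - 5 / 3 : ℝ)) := by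
        rw [integral_const_mul]; gcongr
    _ = 2 * C * (x.im ^ (-(2 / 3 : ℝ)) * ‖x‖ ^ (-(4 / 3 : ℝ))) := by
        have h1 : (2 - 5 / 3 - 5 / 3 : ℝ) = -(4 / 3) := by norm_num
        rw [h1]
        ring

theorem arg_mem_Ioo_of_mem_upperHalf {u : ℂ} (hu : u ∈ upperHalf) : arg u ∈ Ioo 0 Real.pi := by
  have hu' : 0 < u.im := hu
  refine ⟨lt_of_le_of_ne (Complex.arg_nonneg_iff.2 hu'.le) fun h => ?_, ?_⟩
  · exact hu'.ne' (Complex.arg_eq_zero_iff.1 h.symm).2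
  · exact Complex.arg_lt_pi_iff.2 (Or.inr hu'.ne')

theorem integral_forkKernel_eq {u : ℂ} (hu : u ∈ upperHalf) :
    ∫ v in upperHalf, forkKernel u v = I * (Real.pi * (Real.pi - 2 * arg u) : ℝ) := by
  obtain ⟨C, -, h⟩ := exists_integral_norm_forkKernel_le
  have hi := (h u hu).1
  rw [← Complex.norm_mul_exp_arg_mul_I u] at hi
  have := integral_forkKernel (norm_pos_iff.2 (ne_zero_of_mem_upperHalf hu))
    (arg_mem_Ioo_of_mem_upperHalf hu) hi
  rwa [Complex.norm_mul_exp_arg_mul_I] at this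

/-! ### The form of the graph in coordinates. -/

theorem dlog_div_apply {V : Type*} [NormedAddCommGroup V] [NormedSpace ℝ V] (L M : V →L[ℝ] ℂ)
    {c : V} (hL : L c ≠ 0) (hM : M c ≠ 0) (v : V) :
    dlog (fun w => L w / M w) c v = L v / L c - M v / M c := by
  have h1 : HasFDerivAt (fun w => (M w)⁻¹)
      ((-ContinuousLinearMap.mulLeftRight ℝ ℂ (M c)⁻¹ (M c)⁻¹).comp M) c :=
    (hasFDerivAt_inv' hM).comp c M.hasFDerivAt
  have h2 := L.hasFDerivAt.mul h1 (x := c)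
  have h3 : (fun w => L w / M w) = (fun w => L w) * fun w => (M w)⁻¹ := by
    funext w; simp [div_eq_mul_inv]
  rw [h3, dlog, h2.fderiv]
  simp
  field_simp
  ring

/-- The position of a vertex as a linear map on the space of configurations. -/
def positionCLM {n m : ℕ} (s : Fin n ⊕ Fin m) : Points n m →L[ℝ] ℂ :=
  Sum.elim
    (fun p => (ContinuousLinearMap.proj p).comp (ContinuousLinearMap.fst ℝ _ _))
    (fun q => ofRealCLM.comp
      ((ContinuousLinearMap.proj q).comp (ContinuousLinearMap.snd ℝ _ _))) s

theorem positionCLM_apply {n m : ℕ} (s : Fin n ⊕ Fin m) (c : Points n m) :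
    positionCLM s c = position s c := by
  cases s <;> rfl

/-- The four coefficients of the interpolating propagator. -/
theorem propagator_apply {n m : ℕ} (t : ℝ) (p : Fin n) (s : Fin n ⊕ Fin m) (c v : Points n m)
    (h1 : c.1 p - position s c ≠ 0) (h2 : starRingEnd ℂ (c.1 p) - position s c ≠ 0) :
    propagator t p s c v = 1 / (2 * Real.pi * I) *
      (((1 - t) / (c.1 p - position s c) + t / (c.1 p - starRingEnd ℂ (position s c))) * v.1 p
      - ((1 - t) / (starRingEnd ℂ (c.1 p) - position s c) +
          t / (starRingEnd ℂ (c.1 p) - starRingEnd ℂ (position s c))) * starRingEnd ℂ (v.1 p)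
      + (1 - t) * (1 / (starRingEnd ℂ (c.1 p) - position s c) - 1 / (c.1 p - position s c)) *
          position s v
      + t * (1 / (starRingEnd ℂ (c.1 p) - starRingEnd ℂ (position s c)) -
          1 / (c.1 p - starRingEnd ℂ (position s c))) * starRingEnd ℂ (position s v)) := by
  have h3 : starRingEnd ℂ (c.1 p) - starRingEnd ℂ (position s c) ≠ 0 := by
    rw [← map_sub]; exact (map_ne_zero _).2 h1
  have h4 : c.1 p - starRingEnd ℂ (position s c) ≠ 0 := by
    rw [← Complex.conj_conj (c.1 p), ← map_sub]; exact (map_ne_zero _).2 h2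
  set P : Points n m →L[ℝ] ℂ := positionCLM (Sum.inl p) with hP
  set S : Points n m →L[ℝ] ℂ := positionCLM s with hS
  set J : ℂ →L[ℝ] ℂ := (conjCLE : ℂ →L[ℝ] ℂ) with hJ
  have eP : ∀ w, P w = w.1 p := fun w => rfl
  have eS : ∀ w, S w = position s w := positionCLM_apply s
  have eJ : ∀ w, J w = starRingEnd ℂ w := fun w => rfl
  have r1 : ratio p s = fun w => (P - S) w / (J.comp P - S) w := by
    funext w
    simp [ratio, crossRatioInfty, eP, eS, eJ]
  have r2 : ratioConj p s = fun w => (P - J.comp S) w / (J.comp P - J.comp S) w := by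
    funext w
    simp [ratioConj, crossRatioInfty, eP, eS, eJ]
  rw [propagator, r1, r2]
  simp only [add_apply, smul_apply, smul_eq_mul]
  rw [dlog_div_apply, dlog_div_apply]
  · simp only [sub_apply, ContinuousLinearMap.comp_apply, eP, eS, eJ]
    ring
  all_goals
    simpa only [sub_apply, ContinuousLinearMap.comp_apply, eP, eS, eJ]

theorem fderiv_normalized {n : ℕ} (z v : Fin n → ℂ) :
    fderiv ℝ (normalized (n := n)) z v = (v, 0) := by
  have h : HasFDerivAt (normalized (n := n))
      ((ContinuousLinearMap.id ℝ (Fin n → ℂ)).prod 0) z :=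
    (hasFDerivAt_id z).prodMk (hasFDerivAt_const _ z)
  rw [h.fderiv]
  rfl

theorem frame_three_apply (j : Fin (3 * 2)) (p : Fin 3) :
    frame 3 j p = (![![1, I, 0, 0, 0, 0], ![0, 0, 1, I, 0, 0], ![0, 0, 0, 0, 1, I]] :
      Fin 3 → Fin 6 → ℂ) p j := by
  have hj : ∀ j : Fin (3 * 2), (finProdFinEquiv.symm j : Fin 3 × Fin 2) =
      ((![0, 0, 1, 1, 2, 2] : Fin 6 → Fin 3) j, (![0, 1, 0, 1, 0, 1] : Fin 6 → Fin 2) j) := by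
    decide
  simp only [frame, hj]
  fin_cases j <;> fin_cases p <;> simp

/-- The columns are `dx, dx̄, dy, dȳ, dz, dz̄` and the rows are the edges. The last two columns meet
only the edges leaving `z`, whose minor splits off. In the remaining block, Laplace expansion along
the `x`-columns leaves two products of minors. -/
theorem det_six_zeta_pattern (a0 a1 a2 a3 b2 b3 c0 c1 c2 c3 d0 d1 e0 e1 e4 e5 f4 f5 : ℂ) :
    Matrix.det !![a0, a1, a2, a3, 0, 0; 0, 0, b2, b3, 0, 0; c0, c1, c2, c3, 0, 0;
      d0, d1, 0, 0, 0, 0; e0, e1, 0, 0, e4, e5; 0, 0, 0, 0, f4, f5] =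
    ((c0 * d1 - c1 * d0) * (a2 * b3 - a3 * b2) - (a0 * d1 - a1 * d0) * (c2 * b3 - c3 * b2)) *
      (e4 * f5 - e5 * f4) := by
  simp [Matrix.det_succ_row_zero, Fin.sum_univ_succ, Fin.succAbove]
  ring

/-- Integrand for the vertex `z`. -/
def forkDensity (t : ℝ) (x z : ℂ) : ℂ :=
  -2 * I * (1 / (2 * Real.pi * I)) ^ 2 * ((1 - t) * forkKernel (x - 1) (z - 1) -
    t * starRingEnd ℂ (forkKernel (x - 1) (z - 1)))

/-- The coefficient of the four-form of the edges between `x`, `y`, `0`, `1`, up to a constant and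
before interpolation. -/
def pairForm (x y : ℂ) : ℂ :=
  -((x - starRingEnd ℂ x) / ((x - 1) * (starRingEnd ℂ x - 1))) * pairKernel x y

/-- Integrand for the vertices `x` and `y`. -/
def pairDensity (t : ℝ) (x y : ℂ) : ℂ :=
  -4 * (1 / (2 * Real.pi * I)) ^ 4 * ((1 - t) * pairForm x y +
    t * starRingEnd ℂ (pairForm x y))

/-- Capital letters stand for conjugates, treated as independent variables. The minus sign on the
second term reflects `dz ∧ dz̄` changing sign under conjugation. -/
theorem fork_coefficient_identity {t u U v V : ℂ} (h1 : v - u ≠ 0) (h2 : V - u ≠ 0)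
    (h3 : v - U ≠ 0) (h4 : V - U ≠ 0) (hv : v ≠ 0) (hV : V ≠ 0) :
    ((1 - t) / (v - u) + t / (v - U)) * (-(1 / V)) -
        (-((1 - t) / (V - u) + t / (V - U))) * (1 / v) =
      (1 - t) * (u * (v - V) / ((v - u) * (V - u) * (v * V))) -
        t * (U * (V - v) / ((V - U) * (v - U) * (V * v))) := by
  field_simp
  ring

/-- The left side is the coefficient at `t = 0`, expanded, after the double poles `1 / (x - y)²` of
its two products have cancelled. Only a simple pole at `x = y` survives. -/
theorem pair_closed_form {x X y Y : ℂ} (h1 : x - y ≠ 0) (h2 : x - Y ≠ 0)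
    (h3 : X - y ≠ 0) (hy : y ≠ 0) (hY : Y ≠ 0) (hx : x - 1 ≠ 0) (hX : X - 1 ≠ 0) :
    1 / Y * (1 / (X - 1)) * (1 / (x - Y) * (1 / (X - y)) -
        1 / (x - y) * (1 / (x - Y) + 1 / (X - y))) -
      1 / y * (1 / (x - 1)) * (1 / (x - Y) * (1 / (X - y))) +
      1 / Y * (1 / (x - 1)) * (1 / (x - y) * (1 / (X - y))) +
      1 / y * (1 / (X - 1)) * (1 / (x - y) * (1 / (x - Y))) =
    -((x - X) / ((x - 1) * (X - 1))) *
      ((y - Y) / ((y * Y) * ((x - Y) * (X - y) * (x - y)))) := by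
  field_simp
  ring

/-- Two edges depend on `t`, so the left side is a priori quadratic in `t`. Its mixed coefficient is
the sum of the two extreme ones, and these are `pair_closed_form` and its conjugate. -/
theorem pair_coefficient_identity {t x X y Y : ℂ} (h1 : x - y ≠ 0) (h2 : x - Y ≠ 0)
    (h3 : X - y ≠ 0) (h4 : X - Y ≠ 0) (hy : y ≠ 0) (hY : Y ≠ 0) (hx : x - 1 ≠ 0)
    (hX : X - 1 ≠ 0) :
    (((1 - t) / (x - y) + t / (x - Y)) * (-(1 / (X - 1))) -
        (-((1 - t) / (X - y) + t / (X - Y))) * (1 / (x - 1))) *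
      (((1 - t) / (y - x) + t / (y - X)) * (-(1 / Y)) -
        (-((1 - t) / (Y - x) + t / (Y - X))) * (1 / y)) -
    ((1 - t) * (1 / (Y - x) - 1 / (y - x)) * (-(1 / (X - 1))) -
        t * (1 / (Y - X) - 1 / (y - X)) * (1 / (x - 1))) *
      ((1 - t) * (1 / (X - y) - 1 / (x - y)) * (-(1 / Y)) -
        t * (1 / (X - Y) - 1 / (x - Y)) * (1 / y)) =
      (1 - t) * (-((x - X) / ((x - 1) * (X - 1))) *
          ((y - Y) / ((y * Y) * ((x - Y) * (X - y) * (x - y))))) +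
        t * (-((X - x) / ((X - 1) * (x - 1))) *
          ((Y - y) / ((Y * y) * ((X - y) * (x - Y) * (X - Y))))) := by
  rw [← pair_closed_form h1 h2 h3 hy hY hx hX, ← pair_closed_form h4 h3 h2 hY hy hX hx,
    ← neg_sub x y, ← neg_sub x Y, ← neg_sub X y, ← neg_sub X Y]
  simp only [div_eq_mul_inv, inv_neg]
  ring

theorem conj_pairForm (x y : ℂ) : starRingEnd ℂ (pairForm x y) =
    -((starRingEnd ℂ x - x) / ((starRingEnd ℂ x - 1) * (x - 1))) *
      ((starRingEnd ℂ y - y) / ((starRingEnd ℂ y * y) *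
        ((starRingEnd ℂ x - y) * (x - starRingEnd ℂ y) *
          (starRingEnd ℂ x - starRingEnd ℂ y)))) := by
  simp [pairForm, pairKernel]

theorem conj_forkKernel (u v : ℂ) : starRingEnd ℂ (forkKernel u v) =
    starRingEnd ℂ u * (starRingEnd ℂ v - v) /
      ((starRingEnd ℂ v - starRingEnd ℂ u) * (v - starRingEnd ℂ u) * (starRingEnd ℂ v * v)) := by
  simp [forkKernel]

theorem sub_conj_ne_zero {x y : ℂ} (hx : x ∈ upperHalf) (hy : y ∈ upperHalf) :
    x - starRingEnd ℂ y ≠ 0 := by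
  have hx' : 0 < x.im := hx
  have hy' : 0 < y.im := hy
  intro h
  have := congrArg Complex.im h
  simp at this
  linarith

theorem sub_ofReal_mem_upperHalf {x : ℂ} (hx : x ∈ upperHalf) (r : ℝ) :
    x - r ∈ upperHalf := by
  have hx' : 0 < x.im := hx
  simpa [upperHalf] using hx'

set_option maxRecDepth 2000 in
/-- The change of basis from the forms `dx`, `d x̄`, … to real coordinates. -/
theorem det_real_frame : Matrix.det (!![1, I, 0, 0, 0, 0; 1, -I, 0, 0, 0, 0; 0, 0, 1, I, 0, 0;
    0, 0, 1, -I, 0, 0; 0, 0, 0, 0, 1, I; 0, 0, 0, 0, 1, -I] : Matrix (Fin 6) (Fin 6) ℂ) =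
    (-2 * I) ^ 3 := by
  simp [Matrix.det_succ_row_zero, Fin.sum_univ_succ, Fin.succAbove]
  ring

theorem chartDensity_graphForm {n : ℕ} (Γ : AdmissibleGraph n 2 (n * 2)) (t : ℝ)
    (z : Fin n → ℂ) : chartDensity (graphForm Γ t) z = Matrix.det (Matrix.of fun i j =>
      propagator t (Γ.source i) (Γ.target i) (normalized z) (frame n j, 0)) := by
  simp only [chartDensity, fderiv_normalized]
  rfl

/-- The coefficient of the form of the graph in the coordinates of the moduli space. -/
theorem chartDensity_zetaGraph (t : ℝ) {z : Fin 3 → ℂ} (hz : z ∈ interiorConf 3) :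
    chartDensity (graphForm zetaGraph t) z =
      pairDensity t (z 0) (z 1) * forkDensity t (z 0) (z 2) := by
  obtain ⟨him, hinj⟩ := hz
  have hx : z 0 ∈ upperHalf := him 0
  have hy : z 1 ∈ upperHalf := him 1
  have hzz : z 2 ∈ upperHalf := him 2
  have hxy : z 0 - z 1 ≠ 0 := sub_ne_zero.2 fun h => absurd (hinj h) (by decide)
  have hxz : z 2 - z 0 ≠ 0 := sub_ne_zero.2 fun h => absurd (hinj h) (by decide)
  have conj_ne : ∀ {a : ℂ}, a ≠ 0 → starRingEnd ℂ a ≠ 0 := fun h => (map_ne_zero _).2 h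
  have e1 : ∀ {a b : ℂ}, a ∈ upperHalf → b ∈ upperHalf → starRingEnd ℂ a - b ≠ 0 :=
    fun ha hb h => sub_conj_ne_zero hb ha (by rw [← neg_sub, h, neg_zero])
  have x1 := ne_zero_of_mem_upperHalf (sub_ofReal_mem_upperHalf hx 1)
  have z1 := ne_zero_of_mem_upperHalf (sub_ofReal_mem_upperHalf hzz 1)
  have y0 := ne_zero_of_mem_upperHalf hy
  rw [ofReal_one] at x1 z1
  have X1 := conj_ne x1
  have Z1 := conj_ne z1
  have Y0 := conj_ne y0
  rw [map_sub, map_one] at X1 Z1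
  have hXY := conj_ne hxy
  have hXZ := conj_ne hxz
  rw [map_sub] at hXY hXZ
  have q0 := @propagator_apply 3 2 t 1 (Sum.inl 0) (normalized z)
  have q1 := @propagator_apply 3 2 t 1 (Sum.inr 0) (normalized z)
  have q2 := @propagator_apply 3 2 t 0 (Sum.inl 1) (normalized z)
  have q3 := @propagator_apply 3 2 t 0 (Sum.inr 1) (normalized z)
  have q4 := @propagator_apply 3 2 t 2 (Sum.inl 0) (normalized z)
  have q5 := @propagator_apply 3 2 t 2 (Sum.inr 1) (normalized z)
  simp only [normalized, position, Sum.elim_inl, Sum.elim_inr, Matrix.cons_val_zero,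
    Matrix.cons_val_one, ofReal_zero, ofReal_one, map_zero, map_one, sub_zero] at q0 q1 q2 q3 q4 q5
  have hyx : z 1 - z 0 ≠ 0 := by rwa [← neg_sub, neg_ne_zero]
  have r0 := fun v => q0 v hyx (e1 hy hx)
  have r1 := fun v => q1 v y0 Y0
  have r2 := fun v => q2 v hxy (e1 hx hy)
  have r3 := fun v => q3 v x1 X1
  have r4 := fun v => q4 v hxz (e1 hzz hx)
  have r5 := fun v => q5 v z1 Z1
  clear q0 q1 q2 q3 q4 q5
  have fork := fork_coefficient_identity (t := t) (u := z 0 - 1) (U := starRingEnd ℂ (z 0) - 1)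
    (v := z 2 - 1) (V := starRingEnd ℂ (z 2) - 1) (by simpa) (by simpa using e1 hzz hx)
    (by simpa using sub_conj_ne_zero hzz hx) (by simpa) z1 Z1
  have pair := pair_coefficient_identity (t := t) hxy (sub_conj_ne_zero hx hy) (e1 hx hy) hXY
    y0 Y0 x1 X1
  have hG := conj_forkKernel (z 0 - 1) (z 2 - 1)
  have hP := conj_pairForm (z 0) (z 1)
  simp only [sub_sub_sub_cancel_right] at fork
  simp only [map_sub, map_one, sub_sub_sub_cancel_right] at hG
  rw [forkDensity, pairDensity, hG, hP]
  simp only [forkKernel, pairForm, pairKernel, map_sub, map_one, sub_sub_sub_cancel_right]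
  rw [← fork, ← pair]
  clear fork pair hG hP
  have hdet : chartDensity (graphForm zetaGraph t) z = Matrix.det (Matrix.of fun i j =>
      propagator t (zetaGraph.source i) (zetaGraph.target i) (z, ![0, 1]) (frame 3 j, 0)) :=
    chartDensity_graphForm _ _ _
  rw [hdet]
  generalize starRingEnd ℂ (z 0) = X at *
  generalize starRingEnd ℂ (z 1) = Y at *
  generalize starRingEnd ℂ (z 2) = Z at *
  generalize 1 / (2 * (Real.pi : ℂ) * I) = k at *
  set x := z 0
  set y := z 1
  set w := z 2
  -- The first factor holds the coefficients on `dx, dx̄, dy, dȳ, dz, dz̄`; the second evaluates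
  -- these forms on the real frame.
  have hM : (Matrix.of fun i j : Fin 6 =>
      propagator t (zetaGraph.source i) (zetaGraph.target i) (z, ![0, 1]) (frame 3 j, 0)) =
      !![k * ((1 - t) * (1 / (Y - x) - 1 / (y - x))), k * (t * (1 / (Y - X) - 1 / (y - X))),
          k * ((1 - t) / (y - x) + t / (y - X)), k * -((1 - t) / (Y - x) + t / (Y - X)), 0, 0;
        0, 0, k * (1 / y), k * -(1 / Y), 0, 0;
        k * ((1 - t) / (x - y) + t / (x - Y)), k * -((1 - t) / (X - y) + t / (X - Y)),
          k * ((1 - t) * (1 / (X - y) - 1 / (x - y))), k * (t * (1 / (X - Y) - 1 / (x - Y))), 0, 0;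
        k * (1 / (x - 1)), k * -(1 / (X - 1)), 0, 0, 0, 0;
        k * ((1 - t) * (1 / (Z - x) - 1 / (w - x))), k * (t * (1 / (Z - X) - 1 / (w - X))), 0, 0,
          k * ((1 - t) / (w - x) + t / (w - X)), k * -((1 - t) / (Z - x) + t / (Z - X));
        0, 0, 0, 0, k * (1 / (w - 1)), k * -(1 / (Z - 1))] *
      (!![1, I, 0, 0, 0, 0; 1, -I, 0, 0, 0, 0; 0, 0, 1, I, 0, 0; 0, 0, 1, -I, 0, 0;
        0, 0, 0, 0, 1, I; 0, 0, 0, 0, 1, -I] : Matrix (Fin 6) (Fin 6) ℂ) := by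
    ext i j
    rw [Matrix.of_apply, Matrix.mul_apply]
    simp only [Fin.sum_univ_six]
    fin_cases i
    · refine (r0 (frame 3 j, 0)).trans ?_
      simp only [frame_three_apply]
      fin_cases j <;> simp <;> ring
    · refine (r1 (frame 3 j, 0)).trans ?_
      simp only [frame_three_apply]
      fin_cases j <;> simp <;> ring
    · refine (r2 (frame 3 j, 0)).trans ?_
      simp only [frame_three_apply]
      fin_cases j <;> simp <;> ring
    · refine (r3 (frame 3 j, 0)).trans ?_
      simp only [frame_three_apply]
      fin_cases j <;> simp <;> ring
    · refine (r4 (frame 3 j, 0)).trans ?_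
      simp only [frame_three_apply]
      fin_cases j <;> simp <;> ring
    · refine (r5 (frame 3 j, 0)).trans ?_
      simp only [frame_three_apply]
      fin_cases j <;> simp <;> ring
  refine (congrArg Matrix.det hM).trans ?_
  rw [Matrix.det_mul, det_real_frame, det_six_zeta_pattern]
  -- Each complex coordinate contributes `-2i`: the `-4` from `x` and `y` belongs to `pairDensity`,
  -- the remaining factor from `z` to `forkDensity`.
  have hI : (-2 * I) ^ 3 = -4 * (-2 * I) := by linear_combination (-8 * I) * I_sq
  rw [hI]
  ring

/-! ### Integrating out `y` and `z` for general `t`. -/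

theorem preimage_sub_upperHalf (r : ℝ) : (fun w : ℂ => w - r) ⁻¹' upperHalf = upperHalf := by
  ext w; simp [upperHalf]

theorem integrableOn_comp_sub_upperHalf {f : ℂ → ℂ} (hf : IntegrableOn f upperHalf) (r : ℝ) :
    IntegrableOn (fun w => f (w - r)) upperHalf := by
  have h := (measurePreserving_sub_right volume (r : ℂ)).integrableOn_comp_preimage
    (measurableEmbedding_subRight (r : ℂ)) (f := f) (s := upperHalf)
  rw [preimage_sub_upperHalf] at h
  exact h.2 hf

theorem setIntegral_comp_sub_upperHalf {E : Type*} [NormedAddCommGroup E] [NormedSpace ℝ E]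
    (f : ℂ → E) (r : ℝ) :
    ∫ w in upperHalf, f (w - r) = ∫ w in upperHalf, f w := by
  have h := (measurePreserving_sub_right volume (r : ℂ)).setIntegral_preimage_emb
    (measurableEmbedding_subRight (r : ℂ)) f upperHalf
  rwa [preimage_sub_upperHalf] at h

theorem norm_conj_combination_le (w : ℂ) (t : ℝ) :
    ‖(1 - t) * w + t * starRingEnd ℂ w‖ ≤ (|1 - t| + |t|) * ‖w‖ ∧
    ‖(1 - t) * w - t * starRingEnd ℂ w‖ ≤ (|1 - t| + |t|) * ‖w‖ := by
  have h1 : ‖(1 - t : ℂ) * w‖ = |1 - t| * ‖w‖ := by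
    rw [norm_mul, ← ofReal_one, ← ofReal_sub, norm_real, Real.norm_eq_abs]
  have h2 : ‖(t : ℂ) * starRingEnd ℂ w‖ = |t| * ‖w‖ := by
    rw [norm_mul, norm_real, Real.norm_eq_abs, RCLike.norm_conj]
  constructor
  · refine (norm_add_le _ _).trans (le_of_eq ?_)
    rw [h1, h2]; ring
  · refine (norm_sub_le _ _).trans (le_of_eq ?_)
    rw [h1, h2]; ring

theorem integrable_conj {f : ℂ → ℂ} {μ : Measure ℂ} (hf : Integrable f μ) :
    Integrable (fun w => starRingEnd ℂ (f w)) μ :=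
  (LinearIsometryEquiv.integrable_comp_iff conjLIE).2 hf

theorem exists_integral_norm_forkDensity_le (t : ℝ) : ∃ C : ℝ, 0 ≤ C ∧ ∀ x ∈ upperHalf,
    IntegrableOn (forkDensity t x) upperHalf ∧ ∫ z in upperHalf, ‖forkDensity t x z‖ ≤ C := by
  obtain ⟨C, hC, h⟩ := exists_integral_norm_forkKernel_le
  set K := ‖-2 * I * (1 / (2 * (Real.pi : ℂ) * I)) ^ 2‖ * (|1 - t| + |t|)
  have hK : 0 ≤ K := by positivity
  refine ⟨K * C, by positivity, fun x hx => ?_⟩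
  have hx1 := sub_ofReal_mem_upperHalf hx 1
  rw [ofReal_one] at hx1
  obtain ⟨hi, hle⟩ := h _ hx1
  have hi' := integrableOn_comp_sub_upperHalf hi 1
  have hn := setIntegral_comp_sub_upperHalf (fun w => ‖forkKernel (x - 1) w‖) 1
  simp only [ofReal_one] at hi' hn
  have hint : IntegrableOn (forkDensity t x) upperHalf :=
    ((hi'.const_mul _).sub ((integrable_conj hi').const_mul _)).const_mul _
  refine ⟨hint, ?_⟩
  calc ∫ z in upperHalf, ‖forkDensity t x z‖
      ≤ ∫ z in upperHalf, K * ‖forkKernel (x - 1) (z - 1)‖ := by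
        refine integral_mono hint.norm (hi'.norm.const_mul K) fun z => ?_
        rw [forkDensity, norm_mul]
        exact (mul_le_mul_of_nonneg_left (norm_conj_combination_le _ t).2 (norm_nonneg _)).trans
          (le_of_eq (mul_assoc _ _ _).symm)
    _ ≤ K * C := by
        rw [integral_const_mul, hn]; gcongr

/-- The integral of `forkKernel` is purely imaginary, so conjugation changes its sign and the
coefficients `1 - t` and `t` add up to `1`. -/
theorem integral_forkDensity (t : ℝ) {x : ℂ} (hx : x ∈ upperHalf) :
    ∫ z in upperHalf, forkDensity t x z = ((arg (x - 1) / Real.pi - 1 / 2 : ℝ) : ℂ) := by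
  obtain ⟨C, hC, h⟩ := exists_integral_norm_forkKernel_le
  have hx1 := sub_ofReal_mem_upperHalf hx 1
  rw [ofReal_one] at hx1
  have hi' := integrableOn_comp_sub_upperHalf (h _ hx1).1 1
  have hn := setIntegral_comp_sub_upperHalf (forkKernel (x - 1)) 1
  simp only [ofReal_one] at hi' hn
  simp only [forkDensity]
  rw [integral_const_mul, integral_sub (hi'.const_mul _) ((integrable_conj hi').const_mul _),
    integral_const_mul, integral_const_mul, integral_conj, hn, integral_forkKernel_eq hx1]
  have hpi : (Real.pi : ℂ) ≠ 0 := by exact_mod_cast Real.pi_pos.ne'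
  simp only [map_mul, conj_I, conj_ofReal]
  push_cast
  field_simp
  ring

theorem measurable_pairDensity (t : ℝ) :
    Measurable (fun p : ℂ × ℂ => pairDensity t p.1 p.2) := by
  unfold pairDensity pairForm pairKernel; fun_prop

theorem measurable_forkDensity (t : ℝ) :
    Measurable (fun p : ℂ × ℂ => forkDensity t p.1 p.2) := by
  unfold forkDensity forkKernel; fun_prop

/-- The factor `x.im` of `pairForm` absorbs the singularity `x.im ^ (-2/3)` of the kernel bound; the
leftover `x.im ^ (1/3)` is at most `‖x - 1‖ ^ (1/3)` and lowers the pole at `1` from order `2` to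
`5/3`. -/
theorem exists_integral_norm_pairDensity_le (t : ℝ) : ∃ C : ℝ, 0 ≤ C ∧ ∀ x ∈ upperHalf,
    IntegrableOn (pairDensity t x) upperHalf ∧ ∫ y in upperHalf, ‖pairDensity t x y‖ ≤
      C * (‖x‖ ^ (-(4 / 3 : ℝ)) * ‖x - 1‖ ^ (-(5 / 3 : ℝ))) := by
  obtain ⟨C, hC, h⟩ := exists_integral_norm_pairKernel_le
  set K := ‖-4 * (1 / (2 * (Real.pi : ℂ) * I)) ^ 4‖ * (|1 - t| + |t|)
  have hK : 0 ≤ K := by positivity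
  refine ⟨K * 2 * C, by positivity, fun x hx => ?_⟩
  have hx' : 0 < x.im := hx
  obtain ⟨hi, hle⟩ := h _ hx
  have hform : IntegrableOn (pairForm x) upperHalf := hi.const_mul _
  have hint : IntegrableOn (pairDensity t x) upperHalf :=
    ((hform.const_mul _).add ((integrable_conj hform).const_mul _)).const_mul _
  have hx1 := ne_zero_of_mem_upperHalf (sub_ofReal_mem_upperHalf hx 1)
  rw [ofReal_one] at hx1
  have hN : 0 < ‖x - 1‖ := norm_pos_iff.2 hx1
  have hxN : x.im ≤ ‖x - 1‖ := by
    have := (le_abs_self _).trans (Complex.abs_im_le_norm (x - 1))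
    simpa using this
  have hnorm : ∀ y, ‖pairForm x y‖ = 2 * x.im / ‖x - 1‖ ^ 2 * ‖pairKernel x y‖ := by
    intro y
    have : ‖starRingEnd ℂ x - 1‖ = ‖x - 1‖ := by
      rw [← RCLike.norm_conj, map_sub, Complex.conj_conj, map_one]
    rw [pairForm, norm_mul, norm_neg, norm_div, norm_mul, norm_sub_conj_self x hx, this]
    ring
  refine ⟨hint, ?_⟩
  calc ∫ y in upperHalf, ‖pairDensity t x y‖
      ≤ ∫ y in upperHalf, K * (2 * x.im / ‖x - 1‖ ^ 2) * ‖pairKernel x y‖ := by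
        refine integral_mono hint.norm (hi.norm.const_mul _) fun y => ?_
        simp only [pairDensity, K]
        rw [norm_mul, mul_assoc, mul_assoc, mul_assoc, ← hnorm]
        gcongr
        exact (norm_conj_combination_le _ t).1
    _ ≤ K * (2 * x.im / ‖x - 1‖ ^ 2) * (C * (x.im ^ (-(2 / 3 : ℝ)) * ‖x‖ ^ (-(4 / 3 : ℝ)))) := by
        rw [integral_const_mul]; gcongr
    _ = K * 2 * C * (‖x‖ ^ (-(4 / 3 : ℝ)) * (x.im ^ (1 / 3 : ℝ) * ‖x - 1‖ ^ (-2 : ℝ))) := by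
        have h1 : x.im ^ (1 / 3 : ℝ) = x.im * x.im ^ (-(2 / 3 : ℝ)) := by
          rw [← Real.rpow_one_add' hx'.le (by norm_num)]; norm_num
        rw [h1, Real.rpow_neg hN.le, Real.rpow_two]
        field_simp
    _ ≤ K * 2 * C * (‖x‖ ^ (-(4 / 3 : ℝ)) *
          (‖x - 1‖ ^ (1 / 3 : ℝ) * ‖x - 1‖ ^ (-2 : ℝ))) := by gcongr
    _ = _ := by
        rw [← Real.rpow_add hN]; norm_num

theorem integral_pairForm {x : ℂ} (hx : x ∈ upperHalf) :
    ∫ y in upperHalf, pairForm x y =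
      -((x - starRingEnd ℂ x) / ((x - 1) * (starRingEnd ℂ x - 1))) *
        (1 / (‖x‖ : ℂ) ^ 2 * ((Real.pi * (Real.log 2 + Real.log (Real.sin (arg x))) : ℝ) +
          (Real.pi ^ 2 / 2 - Real.pi * arg x : ℝ) * I)) := by
  obtain ⟨C, -, h⟩ := exists_integral_norm_pairKernel_le
  have hi := (h x hx).1
  rw [← Complex.norm_mul_exp_arg_mul_I x] at hi
  have := integral_pairKernel (norm_pos_iff.2 (ne_zero_of_mem_upperHalf hx))
    (arg_mem_Ioo_of_mem_upperHalf hx) hi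
  rw [Complex.norm_mul_exp_arg_mul_I] at this
  simp only [pairForm]
  rw [integral_const_mul, this]

/-- The integrand that remains after integrating out the vertices `y` and `z`. -/
def innerIntegral (t : ℝ) (x : ℂ) : ℂ :=
  -4 * (1 / (2 * Real.pi * I)) ^ 4 *
    ((2 * x.im / (normSq (x - 1) * ‖x‖ ^ 2) : ℝ) * (arg (x - 1) / Real.pi - 1 / 2 : ℝ) *
      ((Real.pi ^ 2 / 2 - Real.pi * arg x : ℝ) -
        I * (1 - 2 * t) * (Real.pi * (Real.log 2 + Real.log (Real.sin (arg x))) : ℝ)))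

theorem measurable_innerIntegral (t : ℝ) : Measurable (innerIntegral t) := by
  unfold innerIntegral
  simp only [Complex.normSq_apply]
  have := Complex.measurable_arg
  have := Real.measurable_log
  fun_prop

/-- The factor `x - x̄` is imaginary, so the logarithmic part of the `y`-integral becomes imaginary
and picks up `(1 - t) - t`, while the angular part becomes real and picks up `(1 - t) + t`. -/
theorem integral_pairDensity_mul_integral_forkDensity (t : ℝ) {x : ℂ} (hx : x ∈ upperHalf) :
    (∫ y in upperHalf, pairDensity t x y) * ∫ z in upperHalf, forkDensity t x z =
      innerIntegral t x := by
  obtain ⟨C, -, h⟩ := exists_integral_norm_pairKernel_le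
  have hform : IntegrableOn (pairForm x) upperHalf := (h x hx).1.const_mul _
  rw [integral_forkDensity t hx]
  simp only [pairDensity]
  rw [integral_const_mul, integral_add (hform.const_mul _) ((integrable_conj hform).const_mul _),
    integral_const_mul, integral_const_mul, integral_conj, integral_pairForm hx, innerIntegral]
  have h1 : (normSq (x - 1) : ℂ) = (x - 1) * (starRingEnd ℂ x - 1) := by
    rw [Complex.normSq_eq_conj_mul_self, map_sub, map_one]; ring
  have h2 : x - starRingEnd ℂ x = 2 * x.im * I := by
    rw [Complex.sub_conj]; push_cast; ring
  simp only [map_mul, map_neg, map_div₀, map_sub, map_add, map_one, Complex.conj_conj, conj_ofReal,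
    map_pow, conj_I, h2, map_ofNat]
  rw [mul_comm (starRingEnd ℂ x - 1), ← h1]
  push_cast
  generalize 1 / (2 * (Real.pi : ℂ) * I) = k
  linear_combination (4 * k ^ 4 * ((arg (x - 1) : ℂ) / Real.pi - 1 / 2) * (2 * x.im) /
    (normSq (x - 1) * (‖x‖ : ℂ) ^ 2) * ((Real.pi : ℂ) ^ 2 / 2 - Real.pi * arg x)) * I_sq

/-! ### Fubini over the three vertices. -/

/-- Integration of a product kernel over three upper half-planes. -/
theorem integrableOn_product_kernel {f g : ℂ → ℂ → ℂ}
    (hf : Measurable fun p : ℂ × ℂ => f p.1 p.2) (hg : Measurable fun p : ℂ × ℂ => g p.1 p.2)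
    (hfi : ∀ x ∈ upperHalf, IntegrableOn (f x) upperHalf)
    (hgi : ∀ x ∈ upperHalf, IntegrableOn (g x) upperHalf)
    (hfg : IntegrableOn (fun x => (∫ y in upperHalf, ‖f x y‖) * ∫ z in upperHalf, ‖g x z‖)
      upperHalf) :
    IntegrableOn (fun p : ℂ × (ℂ × ℂ) => f p.1 p.2.1 * g p.1 p.2.2)
      (upperHalf ×ˢ (upperHalf ×ˢ upperHalf)) := by
  have hm : Measurable (fun p : ℂ × (ℂ × ℂ) => f p.1 p.2.1 * g p.1 p.2.2) :=
    (hf.comp (by fun_prop : Measurable fun p : ℂ × (ℂ × ℂ) => (p.1, p.2.1))).mul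
      (hg.comp (by fun_prop : Measurable fun p : ℂ × (ℂ × ℂ) => (p.1, p.2.2)))
  rw [IntegrableOn, Measure.volume_eq_prod, ← Measure.prod_restrict,
    integrable_prod_iff hm.aestronglyMeasurable, Measure.volume_eq_prod, ← Measure.prod_restrict]
  constructor
  · filter_upwards [ae_restrict_mem measurableSet_upperHalf] with x hx
    exact (hfi x hx).mul_prod (hgi x hx)
  · refine hfg.congr (ae_of_all _ fun x => ?_)
    simp only [norm_mul]
    exact (integral_prod_mul (fun y => ‖f x y‖) fun z => ‖g x z‖).symm

theorem integrableOn_pairDensity_mul_forkDensity (t : ℝ) :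
    IntegrableOn (fun p : ℂ × (ℂ × ℂ) => pairDensity t p.1 p.2.1 * forkDensity t p.1 p.2.2)
      (upperHalf ×ˢ (upperHalf ×ˢ upperHalf)) := by
  obtain ⟨C, hC, hp⟩ := exists_integral_norm_pairDensity_le t
  obtain ⟨D, hD, hq⟩ := exists_integral_norm_forkDensity_le t
  obtain ⟨K, hK, hr⟩ := exists_integral_mul_rpow_le (a := 4 / 3) (b := 5 / 3)
    (by norm_num) (by norm_num) (by norm_num)
  refine integrableOn_product_kernel (measurable_pairDensity t) (measurable_forkDensity t)
    (fun x hx => (hp x hx).1) (fun x hx => (hq x hx).1) ?_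
  have hb : IntegrableOn (fun x : ℂ => C * (‖x‖ ^ (-(4 / 3 : ℝ)) * ‖x - 1‖ ^ (-(5 / 3 : ℝ))) * D)
      upperHalf := (((hr 1 one_ne_zero).1.const_mul C).mul_const D).integrableOn
  refine hb.mono' ?_ ?_
  · have h1 : StronglyMeasurable fun x => ∫ y in upperHalf, ‖pairDensity t x y‖ :=
      (measurable_pairDensity t).norm.stronglyMeasurable.integral_prod_right
    have h2 : StronglyMeasurable fun x => ∫ y in upperHalf, ‖forkDensity t x y‖ :=
      (measurable_forkDensity t).norm.stronglyMeasurable.integral_prod_right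
    exact (h1.mul h2).aestronglyMeasurable
  · filter_upwards [ae_restrict_mem measurableSet_upperHalf] with x hx
    have n1 : 0 ≤ ∫ y in upperHalf, ‖pairDensity t x y‖ := integral_nonneg fun _ => norm_nonneg _
    have n2 : 0 ≤ ∫ y in upperHalf, ‖forkDensity t x y‖ := integral_nonneg fun _ => norm_nonneg _
    rw [Real.norm_of_nonneg (mul_nonneg n1 n2)]
    exact mul_le_mul (hp x hx).2 (hq x hx).2 n2 (n1.trans (hp x hx).2)

theorem integrableOn_innerIntegral (t : ℝ) : IntegrableOn (innerIntegral t) upperHalf ∧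
    ∫ p in upperHalf ×ˢ (upperHalf ×ˢ upperHalf),
      pairDensity t p.1 p.2.1 * forkDensity t p.1 p.2.2 = ∫ x in upperHalf, innerIntegral t x := by
  have h := integrableOn_pairDensity_mul_forkDensity t
  rw [IntegrableOn, Measure.volume_eq_prod, ← Measure.prod_restrict] at h
  have hinner : ∀ᵐ x ∂volume.restrict upperHalf,
      ∫ q, pairDensity t x q.1 * forkDensity t x q.2
        ∂((volume : Measure (ℂ × ℂ)).restrict (upperHalf ×ˢ upperHalf)) = innerIntegral t x := by
    filter_upwards [ae_restrict_mem measurableSet_upperHalf] with x hx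
    rw [Measure.volume_eq_prod, ← Measure.prod_restrict,
      integral_prod_mul (fun y => pairDensity t x y) fun z => forkDensity t x z,
      integral_pairDensity_mul_integral_forkDensity t hx]
  constructor
  · exact h.integral_prod_left.congr hinner
  · rw [Measure.volume_eq_prod, ← Measure.prod_restrict, integral_prod _ h]
    exact integral_congr_ae hinner

/-! ### The final integral over `x`. -/

/-- The integrand is odd about `π / 2`. This removes the part of the weight without the factor `1 -
2t`. -/
theorem integral_cubic_antisymmetric :
    ∫ φ in (0 : ℝ)..Real.pi, φ * (Real.pi - φ) * (Real.pi ^ 2 / 2 - Real.pi * φ) = 0 := by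
  have h : ∀ φ : ℝ, φ * (Real.pi - φ) * (Real.pi ^ 2 / 2 - Real.pi * φ) =
      Real.pi ^ 3 / 2 * φ ^ 1 - 3 * Real.pi ^ 2 / 2 * φ ^ 2 + Real.pi * φ ^ 3 := fun φ => by ring
  simp only [h]
  rw [intervalIntegral.integral_add (Continuous.intervalIntegrable (by fun_prop) _ _)
      (Continuous.intervalIntegrable (by fun_prop) _ _),
    intervalIntegral.integral_sub (Continuous.intervalIntegrable (by fun_prop) _ _)
      (Continuous.intervalIntegrable (by fun_prop) _ _)]
  simp only [intervalIntegral.integral_const_mul, integral_pow]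
  norm_num
  ring

theorem integral_innerIntegral (t : ℝ) :
    ∫ x in upperHalf, innerIntegral t x =
      (1 - 2 * (t : ℂ)) * (riemannZeta 3 / (2 * (Real.pi : ℂ) * I) ^ 3) := by
  rw [integral_polar_upperHalf (measurable_innerIntegral t) (integrableOn_innerIntegral t).1]
  have hφ : EqOn (fun φ : ℝ => ∫ r in Ioi (0 : ℝ), (r : ℂ) * innerIntegral t (r * exp (φ * I)))
      (fun φ : ℝ => -4 * (1 / (2 * Real.pi * I)) ^ 4 / Real.pi *
        ((φ * (Real.pi - φ) * (Real.pi ^ 2 / 2 - Real.pi * φ) : ℝ) -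
          I * (1 - 2 * t) * Real.pi * (φ * (Real.pi - φ) *
            (Real.log 2 + Real.log (Real.sin φ)) : ℝ))) (Ioo 0 Real.pi) := by
    intro φ hφ
    have hs : Real.sin φ ≠ 0 := (Real.sin_pos_of_pos_of_lt_pi hφ.1 hφ.2).ne'
    -- The Jacobian `r`, the `x.im = r sin φ` and the `‖x‖ ^ 2 = r²` cancel, leaving `2 sin φ`; this
    -- later cancels the `1 / sin φ` of the radial integral.
    have hr : EqOn (fun r : ℝ => (r : ℂ) * innerIntegral t (r * exp (φ * I)))
        (fun r : ℝ => -4 * (1 / (2 * Real.pi * I)) ^ 4 * (2 * Real.sin φ) *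
          ((Real.pi ^ 2 / 2 - Real.pi * φ : ℝ) -
            I * (1 - 2 * t) * (Real.pi * (Real.log 2 + Real.log (Real.sin φ)) : ℝ)) *
          (((arg (r * exp (φ * I) - 1) / Real.pi - 1 / 2) /
            normSq (r * exp (φ * I) - 1) : ℝ) : ℂ)) (Ioi 0) := by
      intro r hr
      have hr' : 0 < r := hr
      have harg : arg (r * exp (φ * I)) = φ := by
        rw [Complex.arg_real_mul _ hr', Complex.exp_mul_I]
        exact Complex.arg_cos_add_sin_mul_I ⟨by linarith [hφ.1, Real.pi_pos], hφ.2.le⟩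
      have hn : ‖(r : ℂ) * exp (φ * I)‖ = r := by
        rw [norm_mul, Complex.norm_exp_ofReal_mul_I, mul_one, norm_real,
          Real.norm_of_nonneg hr'.le]
      have him : ((r : ℂ) * exp (φ * I)).im = r * Real.sin φ := by
        rw [Complex.im_ofReal_mul, Complex.exp_ofReal_mul_I_im]
      simp only [innerIntegral, harg, hn, him]
      have hr0 : (r : ℂ) ≠ 0 := by exact_mod_cast hr'.ne'
      generalize normSq (r * exp (φ * I) - 1) = N
      generalize arg (r * exp (φ * I) - 1) = A
      generalize Real.sin φ = S
      push_cast
      field_simp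
    have hpi := Real.pi_pos.ne'
    have hsC : (Real.sin φ : ℂ) ≠ 0 := by exact_mod_cast hs
    have hpC : (Real.pi : ℂ) ≠ 0 := by exact_mod_cast hpi
    simp only
    rw [setIntegral_congr_fun measurableSet_Ioi hr, integral_const_mul, integral_complex_ofReal,
      integral_arg_div_normSq hφ]
    generalize Real.log (Real.sin φ) = L
    generalize Real.sin φ = S at *
    push_cast
    field_simp
  have hL : IntervalIntegrable (fun x => Real.log 2 + Real.log (Real.sin x)) volume 0 Real.pi :=
    IntervalIntegrable.add (by simp) (intervalIntegrable_log_sin' _ _)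
  have i2 : IntervalIntegrable (fun φ => φ * (Real.pi - φ) *
      (Real.log 2 + Real.log (Real.sin φ))) volume 0 Real.pi := hL.continuousOn_mul (by fun_prop)
  have j2 : IntervalIntegrable (fun φ => ((φ * (Real.pi - φ) *
      (Real.log 2 + Real.log (Real.sin φ)) : ℝ) : ℂ)) volume 0 Real.pi :=
    ⟨i2.1.ofReal, i2.2.ofReal⟩
  rw [setIntegral_congr_fun measurableSet_Ioo hφ, ← integral_Ioc_eq_integral_Ioo,
    ← intervalIntegral.integral_of_le Real.pi_pos.le, intervalIntegral.integral_const_mul,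
    intervalIntegral.integral_sub (Continuous.intervalIntegrable (by fun_prop) _ _)
      (j2.const_mul _), intervalIntegral.integral_const_mul,
    intervalIntegral.integral_ofReal, intervalIntegral.integral_ofReal,
    integral_cubic_antisymmetric, integral_mul_log_two_mul_sin]
  have hz : riemannZeta 3 = ((∑' n : ℕ, 1 / (n : ℝ) ^ 3 : ℝ) : ℂ) := by
    have := zeta_nat_eq_tsum_of_gt_one (k := 3) (by norm_num)
    push_cast at this ⊢
    exact this
  rw [hz]
  have hpC : (Real.pi : ℂ) ≠ 0 := by exact_mod_cast Real.pi_pos.ne'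
  generalize (∑' n : ℕ, 1 / (n : ℝ) ^ 3 : ℝ) = ζ
  push_cast
  field_simp
  ring

/-! ### From configurations to a product of half-planes. -/

/-- The diagonals are proper real subspaces, hence null, so distinctness of the points can be
ignored. -/
theorem interiorConf_ae_eq (n : ℕ) :
    (interiorConf n : Set (Fin n → ℂ)) =ᵐ[volume] {z | ∀ p, z p ∈ upperHalf} := by
  have hnull : ∀ i j : Fin n, i ≠ j → (volume : Measure (Fin n → ℂ)) {z | z i = z j} = 0 := by
    intro i j hij
    let L : (Fin n → ℂ) →ₗ[ℝ] ℂ := (LinearMap.proj (R := ℝ) (φ := fun _ : Fin n => ℂ) i) -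
      LinearMap.proj (R := ℝ) (φ := fun _ : Fin n => ℂ) j
    have hL : {z : Fin n → ℂ | z i = z j} = (LinearMap.ker L : Set (Fin n → ℂ)) := by
      ext z; simp [L, sub_eq_zero]
    rw [hL]
    refine Measure.addHaar_submodule _ _ fun htop => ?_
    have : Pi.single i (1 : ℂ) ∈ LinearMap.ker L := by rw [htop]; trivial
    simp [L, hij.symm] at this
  have hae : ∀ᵐ z : Fin n → ℂ, Function.Injective z := by
    have : ∀ᵐ z : Fin n → ℂ, ∀ i j : Fin n, i ≠ j → z i ≠ z j := by
      refine ae_all_iff.2 fun i => ae_all_iff.2 fun j => ?_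
      by_cases hij : i = j
      · exact ae_of_all _ fun z h => absurd hij h
      · have := measure_eq_zero_iff_ae_notMem.1 (hnull i j hij)
        exact this.mono fun z hz _ => hz
    exact this.mono fun z hz i j h => by
      by_contra hij
      exact hz i j hij h
  filter_upwards [hae] with z hz
  exact propext ⟨fun h => h.1, fun h => ⟨h, hz⟩⟩

/-- Splitting off the three points of a configuration. -/
def tripleEquiv : (Fin 3 → ℂ) ≃ᵐ ℂ × (ℂ × ℂ) :=
  (MeasurableEquiv.piFinSuccAbove (fun _ => ℂ) 0).trans
    ((MeasurableEquiv.refl ℂ).prodCongr MeasurableEquiv.finTwoArrow)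

theorem tripleEquiv_apply (z : Fin 3 → ℂ) : tripleEquiv z = (z 0, (z 1, z 2)) := rfl

theorem measurePreserving_tripleEquiv : MeasurePreserving tripleEquiv :=
  (volume_preserving_piFinSuccAbove (fun _ : Fin 3 => ℂ) 0).trans
    ((MeasurePreserving.id volume).prod (volume_preserving_finTwoArrow ℂ))

theorem preimage_tripleEquiv : tripleEquiv ⁻¹' (upperHalf ×ˢ (upperHalf ×ˢ upperHalf)) =
    {z | ∀ p, z p ∈ upperHalf} := by
  ext z
  simp [tripleEquiv_apply, Fin.forall_fin_succ]

theorem chartDensity_zetaGraph_integral (t : ℝ) :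
    ModuliIntegrable (graphForm zetaGraph t) ∧
      weight zetaGraph t = ∫ x in upperHalf, innerIntegral t x := by
  have hae := interiorConf_ae_eq 3
  have hmeas : MeasurableSet {z : Fin 3 → ℂ | ∀ p, z p ∈ upperHalf} := by
    rw [← preimage_tripleEquiv]
    exact tripleEquiv.measurable (measurableSet_upperHalf.prod
      (measurableSet_upperHalf.prod measurableSet_upperHalf))
  set g : ℂ × (ℂ × ℂ) → ℂ := fun p => pairDensity t p.1 p.2.1 * forkDensity t p.1 p.2.2 with hg
  have hcongr : chartDensity (graphForm zetaGraph t) =ᵐ[volume.restrict (interiorConf 3)]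
      fun z => g (tripleEquiv z) := by
    -- Null measurability of `interiorConf 3`, inherited from the product of half-planes, is enough
    -- here.
    filter_upwards [ae_restrict_mem₀ (hmeas.nullMeasurableSet.congr hae.symm)] with z hz
    exact chartDensity_zetaGraph t hz
  have hint := (measurePreserving_tripleEquiv.integrableOn_comp_preimage
    tripleEquiv.measurableEmbedding).2 (integrableOn_pairDensity_mul_forkDensity t)
  rw [preimage_tripleEquiv] at hint
  constructor
  · exact (hint.congr_set_ae hae).congr hcongr.symm
  · rw [weight, moduliIntegral, integral_congr_ae hcongr, setIntegral_congr_set hae,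
      ← preimage_tripleEquiv, measurePreserving_tripleEquiv.setIntegral_preimage_emb
        tripleEquiv.measurableEmbedding g, (integrableOn_innerIntegral t).2]

end DiskWeights
end

theorem mainTheorem9 (t : ℝ) :
    DiskWeights.ModuliIntegrable (DiskWeights.graphForm DiskWeights.zetaGraph t) ∧
      DiskWeights.weight DiskWeights.zetaGraph t =
        (1 - 2 * (t : ℂ)) * (riemannZeta 3 / (2 * (Real.pi : ℂ) * Complex.I) ^ 3) := by
  obtain ⟨hi, he⟩ := DiskWeights.chartDensity_zetaGraph_integral t
  exact ⟨hi, he.trans (DiskWeights.integral_innerIntegral t)⟩
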